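/- Write $\binom{d}{\le k}=\sum_{j=1}^{k}\binom dj$. An algorithm on datasets of $m$ rows is $(\varepsilon,\delta)$-differentially private if $\Pr[M(x)\in T]\le e^{\varepsilon}\Pr[M(x')\in T]+\delta$ for all datasets $x,x'$ that differ in at most one row and all events $T$. A shuffle protocol $\Pi$ for $n$ users consists of public randomness, a randomizer that maps the data of one user to a vector of messages of arbitrary finite length, and an analyzer, both of which may use $n$ and the public randomness. On $m$ inputs the randomizer is run independently on each of them, and the concatenation of all the resulting vectors is permuted uniformly at random; when $m=n$, the analyzer applied to the result gives the output of $\Pi$. The protocol is $(\varepsilon,\delta,\gamma)$-robustly shuffle private if for every integer $m\ge\gamma n$ the public randomness together with the shuffled messages of $m$ users is an $(\varepsilon,\delta)$-differentially private function of their data. It releases width-$k$ parities with error $\alpha$ and sample complexity $n$ if for every distribution $\mathbf P$ on $\{-1,1\}^d$, on $n$ independent samples from $\mathbf P$ it outputs $F:2^{[d]}\to\mathbb R$ such that, with probability at least $99/100$ over the samples and the protocol, $\left|F(\ell)-\mathbb E_{x\sim\mathbf P}\prod_{j\in\ell}x_j\right|\le\alpha$ for all $\ell\subseteq[d]$ with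 $|\ell|\le k$. **Theorem.** For every $\varepsilon_0>0$ there are constants $c,C>0$, depending only on $\varepsilon_0$, such that the following holds. Let $n\ge 0$, $d\ge2$ and $1\le k\le d$ be integers, $0<\alpha<\tfrac12$, $0<\varepsilon\le\varepsilon_0$ and $0\le\delta\le1$, with $$\delta\log\frac{\binom{d}{\le k}}{\delta}\le c\,\frac{\alpha^2\varepsilon^2}{\binom{d}{\le k}}$$ (the left-hand side being $0$ if $\delta=0$). If $\Pi$ is an $(\varepsilon,\delta,1/3)$-robustly shuffle private protocol for $n$ users that releases width-$k$ parities with error $\alpha$ and sample complexity $n$, then $$n\ge C\,\frac{\sqrt{\binom{d}{\le k}}}{\alpha\varepsilon}.$$ -/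

import Mathlib

open MeasureTheory ProbabilityTheory
open scoped ENNReal BigOperators Nat

namespace ShufflePrivacy

/-! ### Differential privacy -/

/-- Two datasets of `m` rows are neighbors if they differ in at most one row. -/
def Neighbors {X : Type*} {m : ℕ} (x x' : Fin m → X) : Prop :=
  {i | x i ≠ x' i}.Subsingleton

/-- A randomized algorithm, given by the law `M x` of its output on each dataset `x` of `m` rows,
is `(ε, δ)`-differentially private. -/
def IsDifferentiallyPrivate {X R : Type*} [MeasurableSpace R] {m : ℕ} (ε δ : ℝ)
    (M : (Fin m → X) → Measure R) : Prop :=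
  ∀ x x' : Fin m → X, Neighbors x x' → ∀ C : Set R, MeasurableSet C →
    M x C ≤ ENNReal.ofReal (Real.exp ε) * M x' C + ENNReal.ofReal δ

/-! ### Vectors of messages -/

/-- `Y*`: vectors of messages of arbitrary finite length. The sigma-algebra is that of the disjoint
union of the powers of `Y`. -/
abbrev Messages (Y : Type*) : Type _ := Σ m : ℕ, (Fin m → Y)

namespace Messages

variable {Y : Type*}

/-- The vector with no messages. -/
def empty : Messages Y := ⟨0, Fin.elim0⟩

/-- Concatenation of two vectors of messages. -/
def append (p : Messages Y × Messages Y) : Messages Y :=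
  ⟨p.1.1 + p.2.1, Fin.append p.1.2 p.2.2⟩

/-- Rearrangement of the messages by a permutation of the positions. -/
def permute (y : Messages Y) (σ : Equiv.Perm (Fin y.1)) : Messages Y :=
  ⟨y.1, y.2 ∘ σ⟩

theorem measurableSet_iff [MeasurableSpace Y] {s : Set (Messages Y)} :
    MeasurableSet s ↔ ∀ m : ℕ, MeasurableSet {v : Fin m → Y | (⟨m, v⟩ : Messages Y) ∈ s} :=
  MeasurableSpace.measurableSet_iInf

theorem measurable_mk [MeasurableSpace Y] (m : ℕ) :
    Measurable (fun v : Fin m → Y => (⟨m, v⟩ : Messages Y)) :=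
  fun _ hs => measurableSet_iff.1 hs m

theorem measurable_of_forall [MeasurableSpace Y] {Z : Type*} [MeasurableSpace Z]
    {f : Messages Y → Z} (h : ∀ m, Measurable (fun v : Fin m → Y => f ⟨m, v⟩)) :
    Measurable f :=
  fun _ hs => measurableSet_iff.2 fun m => h m hs

theorem measurableEmbedding_mk [MeasurableSpace Y] (m : ℕ) :
    MeasurableEmbedding (fun v : Fin m → Y => (⟨m, v⟩ : Messages Y)) where
  injective := fun v w h => by simpa using h
  measurable := measurable_mk m
  measurableSet_image' := by
    intro s hs
    refine measurableSet_iff.2 fun l => ?_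
    by_cases h : l = m
    · subst h
      convert hs using 1
      ext v
      simp
    · convert MeasurableSet.empty using 1
      ext v
      simp only [Set.mem_image, Set.mem_ofPred_eq, Set.mem_empty_iff_false, iff_false]
      rintro ⟨w, -, hw⟩
      exact h (congrArg Sigma.fst hw).symm

theorem measurable_append [MeasurableSpace Y] :
    Measurable (append : Messages Y × Messages Y → Messages Y) := by
  intro s hs
  have key : append ⁻¹' s = ⋃ a : ℕ, ⋃ b : ℕ,
      Prod.map (fun v : Fin a → Y => (⟨a, v⟩ : Messages Y))
        (fun v : Fin b → Y => (⟨b, v⟩ : Messages Y)) ''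
        {p | (⟨a + b, Fin.append p.1 p.2⟩ : Messages Y) ∈ s} := by
    ext ⟨⟨a, v⟩, ⟨b, w⟩⟩
    simp only [Set.mem_preimage, Set.mem_iUnion, Set.mem_image, Set.mem_ofPred_eq]
    constructor
    · intro h
      exact ⟨a, b, (v, w), h, rfl⟩
    · rintro ⟨a', b', ⟨v', w'⟩, h, he⟩
      rw [← he]
      exact h
  rw [key]
  refine MeasurableSet.iUnion fun a => MeasurableSet.iUnion fun b => ?_
  refine ((measurableEmbedding_mk a).prodMap (measurableEmbedding_mk b)).measurableSet_image.2 ?_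
  have hm : Measurable (fun p : (Fin a → Y) × (Fin b → Y) => Fin.append p.1 p.2) := by
    refine measurable_pi_lambda _ fun i => ?_
    refine Fin.addCases (fun j => ?_) (fun j => ?_) i
    · simp only [Fin.append_left]; fun_prop
    · simp only [Fin.append_right]; fun_prop
  exact ((measurable_mk (a + b)).comp hm) hs

end Messages

/-- The shuffler `Y* → Y*`: it applies a uniformly random permutation to the messages. -/
noncomputable def shuffler (Y : Type*) [MeasurableSpace Y] :
    Kernel (Messages Y) (Messages Y) where
  toFun y := ((y.1 ! : ℕ) : ℝ≥0∞)⁻¹ •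
    ∑ σ : Equiv.Perm (Fin y.1), Measure.dirac (y.permute σ)
  measurable' := by
    refine Messages.measurable_of_forall fun m => ?_
    refine Measure.measurable_of_measurable_coe _ fun s hs => ?_
    simp only [Measure.smul_apply, Measure.finsetSum_apply, smul_eq_mul]
    refine Measurable.const_mul (f := fun v : Fin m → Y => ∑ σ : Equiv.Perm (Fin m),
      Measure.dirac (Messages.permute ⟨m, v⟩ σ) s) ?_ _
    refine Finset.measurable_fun_sum _ fun σ _ => ?_
    refine (Measure.measurable_coe hs).comp (Measure.measurable_dirac.comp ?_)
    exact (Messages.measurable_mk m).comp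
      (measurable_pi_lambda _ fun i => measurable_pi_apply (σ i))

instance isMarkovKernel_shuffler (Y : Type*) [MeasurableSpace Y] :
    IsMarkovKernel (shuffler Y) where
  isProbabilityMeasure y := by
    constructor
    have h0 : ((y.1 ! : ℕ) : ℝ≥0∞) ≠ 0 := by exact_mod_cast Nat.factorial_ne_zero _
    change (((y.1 ! : ℕ) : ℝ≥0∞)⁻¹ •
      ∑ σ : Equiv.Perm (Fin y.1), Measure.dirac (y.permute σ)) Set.univ = 1
    simp [Measure.finsetSum_apply, Fintype.card_perm,
      ENNReal.inv_mul_cancel h0 (ENNReal.natCast_ne_top _)]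

/-! ### Shuffle protocols -/

/-- A (multi-message) shuffle protocol intended for `n` users, with data universe `X`, message
space `Y`, public randomness in `W` and outputs in `O`. The randomizer and the analyzer may depend
arbitrarily on `n`, and both see the public randomness. -/
structure ShuffleProtocol (n : ℕ) (X Y W O : Type*) [MeasurableSpace X] [MeasurableSpace Y]
    [MeasurableSpace W] [MeasurableSpace O] where
  /-- the law of the public randomness -/
  coins : Measure W
  isProbabilityMeasure_coins : IsProbabilityMeasure coins
  /-- the randomizer, which maps the data of one user to a vector of messages -/
  randomizer : Kernel (W × X) (Messages Y)
  isMarkovKernel_randomizer : IsMarkovKernel randomizer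
  /-- the analyzer, which is applied to the shuffled messages -/
  analyzer : Kernel (W × Messages Y) O
  isMarkovKernel_analyzer : IsMarkovKernel analyzer

namespace ShuffleProtocol

variable {n : ℕ} {X Y W O : Type*} [MeasurableSpace X] [MeasurableSpace Y] [MeasurableSpace W]
  [MeasurableSpace O]

instance (Q : ShuffleProtocol n X Y W O) : IsProbabilityMeasure Q.coins :=
  Q.isProbabilityMeasure_coins

instance (Q : ShuffleProtocol n X Y W O) : IsMarkovKernel Q.randomizer :=
  Q.isMarkovKernel_randomizer

instance (Q : ShuffleProtocol n X Y W O) : IsMarkovKernel Q.analyzer :=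
  Q.isMarkovKernel_analyzer

/-- The messages of `m` users with data `x 0, …, x (m - 1)`, given the public randomness: the users
run the randomizer independently, and their vectors of messages are concatenated. -/
noncomputable def messages (Q : ShuffleProtocol n X Y W O) :
    (m : ℕ) → Kernel (W × (Fin m → X)) (Messages Y)
  | 0 => Kernel.const _ (Measure.dirac Messages.empty)
  | m + 1 =>
    (((Q.messages m).comap
        (fun p : W × (Fin (m + 1) → X) => (p.1, fun i : Fin m => p.2 i.castSucc))
        (by fun_prop)) ×ₖ
      (Q.randomizer.comap
        (fun p : W × (Fin (m + 1) → X) => (p.1, p.2 (Fin.last m)))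
        (by fun_prop))).map Messages.append

instance isMarkovKernel_messages (Q : ShuffleProtocol n X Y W O) (m : ℕ) :
    IsMarkovKernel (Q.messages m) := by
  induction m with
  | zero => unfold messages; infer_instance
  | succ m ih => unfold messages; exact Kernel.IsMarkovKernel.map _ Messages.measurable_append

/-- What an observer of the shuffler sees when `m` users with data `x` follow the protocol: the
public randomness together with the shuffled messages. -/
noncomputable def view (Q : ShuffleProtocol n X Y W O) (m : ℕ) (x : Fin m → X) :
    Measure (W × Messages Y) :=
  Q.coins ⊗ₘ
    ((shuffler Y ∘ₖ Q.messages m).comap (fun w : W => (w, x)) (by fun_prop))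

/-- The law of the output of the honest execution of the protocol on a dataset of `n` rows. -/
noncomputable def output (Q : ShuffleProtocol n X Y W O) (x : Fin n → X) : Measure O :=
  (Q.view n x).bind Q.analyzer

/-- `(ε, δ, γ)`-robust shuffle differential privacy: the shuffled messages are
`(ε, δ)`-differentially private whenever the number `m` of users who follow the protocol is at
least a `γ` fraction of the intended number `n`. -/
def IsRobustlyShufflePrivate (Q : ShuffleProtocol n X Y W O) (ε δ γ : ℝ) : Prop :=
  ∀ m : ℕ, γ * n ≤ m → IsDifferentiallyPrivate ε δ (Q.view m)

end ShuffleProtocol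

/-! ### Releasing parities -/

/-- The cube `{-1, 1} ^ d`. -/
abbrev Cube (d : ℕ) : Type := Fin d → ℤˣ

instance : DiscreteMeasurableSpace ℤˣ where
  forall_measurableSet s :=
    ⟨Units.val '' s, MeasurableSet.of_discrete, Set.preimage_image_eq _ Units.val_injective⟩

/-- The parity `∏_{j ∈ ℓ} x_j`, as a real number. -/
def parity {d : ℕ} (ℓ : Finset (Fin d)) (x : Cube d) : ℝ :=
  ∏ j ∈ ℓ, ((x j : ℤ) : ℝ)

/-- The algorithm with output law `M x` on the dataset `x` releases width-`k` parities with error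
`α` and sample complexity `n`: for every distribution `P` on the cube, with probability at least
`99 / 100` over `n` independent samples from `P` and the randomness of the algorithm, the output
`F` is within `α` of the mean under `P` of every parity of width at most `k`. -/
def ReleasesParities {d n : ℕ} (k : ℕ) (α : ℝ)
    (M : (Fin n → Cube d) → Measure (Finset (Fin d) → ℝ)) : Prop :=
  ∀ P : Measure (Cube d), IsProbabilityMeasure P →
    (99 / 100 : ℝ≥0∞) ≤
      ∫⁻ x, M x {F | ∀ ℓ : Finset (Fin d), ℓ.card ≤ k → |F ℓ - ∫ z, parity ℓ z ∂P| ≤ α}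
        ∂(Measure.pi fun _ : Fin n => P)

/-- `binom(d, ≤ k) = ∑_{j = 1}^{k} binom(d, j)`, the number of nonempty subsets of `[d]` of size at
most `k`. -/
def chooseLE (d k : ℕ) : ℕ := ∑ j ∈ Finset.Icc 1 k, d.choose j

end ShufflePrivacy

namespace ShufflePrivacy

/-! ### Differential privacy and bounded test functions -/

/-! Write N for the number of nonempty sets ℓ of size at most k. Let U be the uniform law on the
cube and U_{b,ℓ} the law under which the parity ℓ has mean b and which is otherwise uniform. For a
bias slightly above α, accuracy forces the sign of the ℓ-th output to tell n samples of U_{b,ℓ} from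
n samples of U_{-b,ℓ} with advantage 98/100, for each of the N sets. Robust privacy bounds the sum
of these advantages.

One private user cannot serve many parities at once: by orthogonality of the parities and
Cauchy–Schwarz, an (ε, δ)-private function of one point of the cube has total correlation at most
sinh ε · √N + 2δN with all N of them, even with a different test for each ℓ
(`sum_integral_parity_le`). In a hybrid argument that turns uniform users into biased ones one at a
time, each replacement costs at most β times this quantity (`sum_meanEmpty_biasedUser_pow_le`). The
users already biased depend on ℓ, so they cannot be part of the common private mechanism. They are
absorbed into the test as post-processing, and privacy is required only of the remaining uniform
users together with the one being replaced. This is where robustness enters.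

To keep enough uniform users, the bias is taken to be β/2: such a user is a fair mixture of a user
of bias β and a uniform one, so the number r of users of bias β is binomial with mean n/2. Whenever
privacy applies, the hybrid bound does; otherwise r > 2n/3, and by Markov's inequality this
contributes at most 3/4 per parity (`sum_meanEmpty_sub_le`). Since 3/4 < 98/100, n must be of order
√N / (αε).

Formally, users act on tests rather than on laws: adding a user is a linear operator on bounded
tests invariant under rearrangement. These operators commute, so the binomial theorem applies to
them. -/

theorem integral_le_of_forall_measure_le {Z : Type*} [MeasurableSpace Z] {μ ν : Measure Z}
    [IsProbabilityMeasure μ] [IsProbabilityMeasure ν] {a δ B : ℝ} (ha : 0 ≤ a) (hδ : 0 ≤ δ)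
    (h : ∀ C, MeasurableSet C → μ C ≤ ENNReal.ofReal a * ν C + ENNReal.ofReal δ)
    {f : Z → ℝ} (hf : Measurable f) (h0 : ∀ z, 0 ≤ f z) (hB : ∀ z, f z ≤ B) (hB0 : 0 ≤ B) :
    ∫ z, f z ∂μ ≤ a * ∫ z, f z ∂ν + δ * B := by
  have key : ∫⁻ z, ENNReal.ofReal (f z) ∂μ ≤
      ENNReal.ofReal a * ∫⁻ z, ENNReal.ofReal (f z) ∂ν + ENNReal.ofReal δ * ENNReal.ofReal B := by
    rw [lintegral_eq_lintegral_meas_le μ (Filter.Eventually.of_forall h0) hf.aemeasurable,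
      lintegral_eq_lintegral_meas_le ν (Filter.Eventually.of_forall h0) hf.aemeasurable]
    have hm : Measurable fun t : ℝ => ν {z | t ≤ f z} :=
      Antitone.measurable fun s t hst => measure_mono fun z hz => le_trans hst hz
    -- In the layer-cake formula only levels 0 < t ≤ B contribute, so the additive loss δ is
    -- integrated over an interval of length B.
    have hI : ENNReal.ofReal δ * ENNReal.ofReal B =
        ∫⁻ t in Set.Ioi (0 : ℝ), (Set.Iic B).indicator (fun _ => ENNReal.ofReal δ) t := by
      rw [lintegral_indicator measurableSet_Iic, lintegral_const, Measure.restrict_restrict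
        measurableSet_Iic, Measure.restrict_apply_univ, Set.Iic_inter_Ioi, Real.volume_Ioc,
        sub_zero]
    rw [hI, ← lintegral_const_mul _ hm, ← lintegral_add_left (hm.const_mul _)]
    refine lintegral_mono fun t => ?_
    by_cases ht : t ≤ B
    · simp only [Set.indicator, Set.mem_Iic, ht, if_true]
      exact h _ (measurableSet_le measurable_const hf)
    · have he : {z | t ≤ f z} = ∅ := by
        ext z
        simp only [Set.mem_ofPred_eq, Set.mem_empty_iff_false, iff_false]
        exact fun hz => ht (hz.trans (hB z))
      simp [he]
  rw [integral_eq_lintegral_of_nonneg_ae (Filter.Eventually.of_forall h0)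
    hf.aestronglyMeasurable, integral_eq_lintegral_of_nonneg_ae (Filter.Eventually.of_forall h0)
    hf.aestronglyMeasurable]
  have hfin : ∫⁻ z, ENNReal.ofReal (f z) ∂ν ≠ ∞ := by
    refine ((lintegral_mono fun z => ENNReal.ofReal_le_ofReal (hB z)).trans_lt ?_).ne
    simp
  refine (ENNReal.toReal_mono ?_ key).trans_eq ?_
  · exact ENNReal.add_ne_top.2 ⟨ENNReal.mul_ne_top ENNReal.ofReal_ne_top hfin,
      ENNReal.mul_ne_top ENNReal.ofReal_ne_top ENNReal.ofReal_ne_top⟩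
  · rw [ENNReal.toReal_add (ENNReal.mul_ne_top ENNReal.ofReal_ne_top hfin)
      (ENNReal.mul_ne_top ENNReal.ofReal_ne_top ENNReal.ofReal_ne_top), ENNReal.toReal_mul,
      ENNReal.toReal_mul, ENNReal.toReal_ofReal ha, ENNReal.toReal_ofReal hδ,
      ENNReal.toReal_ofReal hB0]

/-! ### Parities -/

theorem abs_parity {d : ℕ} (ℓ : Finset (Fin d)) (x : Cube d) : |parity ℓ x| = 1 := by
  unfold parity
  rw [Finset.abs_prod]
  refine Finset.prod_eq_one fun j _ => ?_
  rcases Int.units_eq_one_or (x j) with h | h <;> simp [h]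

theorem sum_units_int (f : ℤˣ → ℝ) : ∑ s, f s = f 1 + f (-1) := by
  rw [show (Finset.univ : Finset ℤˣ) = {1, -1} from rfl, Finset.sum_pair (by decide)]

theorem card_cube (d : ℕ) : (Fintype.card (Cube d) : ℝ) = 2 ^ d := by
  simp [Cube]

theorem sum_parity_mul_parity {d : ℕ} (ℓ ℓ' : Finset (Fin d)) :
    ∑ x : Cube d, parity ℓ x * parity ℓ' x = if ℓ = ℓ' then 2 ^ d else 0 := by
  have h1 : ∀ x : Cube d, parity ℓ x * parity ℓ' x =
      ∏ j, ((if j ∈ ℓ then ((x j : ℤ) : ℝ) else 1) * (if j ∈ ℓ' then ((x j : ℤ) : ℝ) else 1)) := by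
    intro x
    rw [Finset.prod_mul_distrib]
    simp [parity]
  simp_rw [h1]
  rw [← Fintype.prod_sum (fun (j : Fin d) (s : ℤˣ) =>
    ((if j ∈ ℓ then ((s : ℤ) : ℝ) else 1) * (if j ∈ ℓ' then ((s : ℤ) : ℝ) else 1)))]
  split_ifs with h
  · subst h
    rw [Finset.prod_congr rfl (g := fun _ => (2 : ℝ))]
    · simp
    · intro j _
      rw [sum_units_int]
      split_ifs <;> norm_num
  · obtain ⟨j, hj⟩ : ∃ j, ¬ (j ∈ ℓ ↔ j ∈ ℓ') := by
      by_contra hc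
      push Not at hc
      exact h (Finset.ext hc)
    refine Finset.prod_eq_zero (Finset.mem_univ j) ?_
    rw [sum_units_int]
    by_cases h1 : j ∈ ℓ <;> by_cases h2 : j ∈ ℓ' <;> simp_all

theorem sum_parity {d : ℕ} {ℓ : Finset (Fin d)} (h : ℓ.Nonempty) :
    ∑ x : Cube d, parity ℓ x = 0 := by
  have := sum_parity_mul_parity ℓ ∅
  rw [if_neg h.ne_empty] at this
  simpa [parity] using this

theorem sum_sq_sum_mul_parity {d : ℕ} (L : Finset (Finset (Fin d)))
    (a : Finset (Fin d) → ℝ) :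
    ∑ x : Cube d, (∑ ℓ ∈ L, a ℓ * parity ℓ x) ^ 2 = 2 ^ d * ∑ ℓ ∈ L, a ℓ ^ 2 := by
  have h1 : ∀ x : Cube d, (∑ ℓ ∈ L, a ℓ * parity ℓ x) ^ 2 =
      ∑ ℓ ∈ L, ∑ ℓ' ∈ L, a ℓ * a ℓ' * (parity ℓ x * parity ℓ' x) := by
    intro x
    rw [sq, Finset.sum_mul_sum]
    exact Finset.sum_congr rfl fun _ _ => Finset.sum_congr rfl fun _ _ => by ring
  simp_rw [h1]
  rw [Finset.sum_comm, Finset.mul_sum]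
  refine Finset.sum_congr rfl fun ℓ hℓ => ?_
  rw [Finset.sum_comm]
  simp_rw [← Finset.mul_sum, sum_parity_mul_parity]
  simp [hℓ]
  ring

/-- The mean absolute value of a combination of parities with coefficients in `[-1, 1]`. -/
theorem sum_abs_sum_mul_parity_le {d : ℕ} (L : Finset (Finset (Fin d)))
    (a : Finset (Fin d) → ℝ) (ha : ∀ ℓ, |a ℓ| ≤ 1) :
    ∑ x : Cube d, |∑ ℓ ∈ L, a ℓ * parity ℓ x| ≤ 2 ^ d * √(L.card : ℝ) := by
  refine abs_le_of_sq_le_sq' ?_ (by positivity) |>.2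
  -- Cauchy–Schwarz reduces the claim to the second moment, which orthogonality computes.
  have h1 := sq_sum_le_card_mul_sum_sq (s := (Finset.univ : Finset (Cube d)))
    (f := fun x => |∑ ℓ ∈ L, a ℓ * parity ℓ x|)
  simp_rw [sq_abs] at h1
  rw [sum_sq_sum_mul_parity, Finset.card_univ, card_cube] at h1
  refine h1.trans ?_
  rw [mul_pow, Real.sq_sqrt (Nat.cast_nonneg _), ← mul_assoc, ← sq]
  gcongr
  refine (Finset.sum_le_sum (g := fun _ => (1 : ℝ)) fun ℓ _ => ?_).trans (by simp)
  rw [← sq_abs]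
  exact pow_le_one₀ (abs_nonneg _) (ha ℓ)

/-- A differentially private function of a single point of the cube correlates weakly with most
parities. -/
theorem sum_integral_parity_le {d : ℕ} {Z : Type*} [MeasurableSpace Z] {ε δ : ℝ} (hδ : 0 ≤ δ)
    (hε : 0 ≤ ε)
    (M : Cube d → Measure Z) [∀ x, IsProbabilityMeasure (M x)]
    (hM : ∀ x x' C, MeasurableSet C →
      M x C ≤ ENNReal.ofReal (Real.exp ε) * M x' C + ENNReal.ofReal δ)
    (L : Finset (Finset (Fin d))) (hL : ∀ ℓ ∈ L, ℓ.Nonempty)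
    (ψ : Finset (Fin d) → Z → ℝ) (hψm : ∀ ℓ, Measurable (ψ ℓ)) (hψ : ∀ ℓ z, |ψ ℓ z| ≤ 1) :
    ∑ ℓ ∈ L, ∑ x, parity ℓ x * ∫ z, ψ ℓ z ∂(M x) ≤
      2 ^ d * (Real.sinh ε * √(L.card : ℝ) + 2 * δ * L.card) := by
  set h : Cube d → Z → ℝ := fun x z => ∑ ℓ ∈ L, ψ ℓ z * parity ℓ x with hh
  have hhm : ∀ x, Measurable (h x) := fun x =>
    Finset.measurable_fun_sum _ fun ℓ _ => (hψm ℓ).mul_const _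
  have hhB : ∀ x z, |h x z| ≤ L.card := by
    intro x z
    refine (Finset.abs_sum_le_sum_abs _ _).trans ?_
    refine (Finset.sum_le_sum (g := fun _ => (1 : ℝ)) fun ℓ _ => ?_).trans (by simp)
    rw [abs_mul, abs_parity, mul_one]
    exact hψ ℓ z
  -- Nonempty parities have mean zero, so for each z the positive and negative parts of `h` have the
  -- same total over the cube.
  have hsum0 : ∀ z, ∑ x, h x z = 0 := by
    intro z
    rw [hh, Finset.sum_comm]
    refine Finset.sum_eq_zero fun ℓ hℓ => ?_
    rw [← Finset.mul_sum, sum_parity (hL ℓ hℓ), mul_zero]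
  have hint : ∀ (μ : Measure Z) [IsProbabilityMeasure μ] {f : Z → ℝ}, Measurable f →
      (∃ B, ∀ z, |f z| ≤ B) → Integrable f μ := by
    rintro μ _ f hf ⟨B, hB⟩
    exact Integrable.of_bound hf.aestronglyMeasurable B
      (Filter.Eventually.of_forall fun z => by simpa using hB z)
  set p : Cube d → Z → ℝ := fun x z => max (h x z) 0
  set q : Cube d → Z → ℝ := fun x z => max (-h x z) 0
  have hpm : ∀ x, Measurable (p x) := fun x => (hhm x).max measurable_const
  have hqm : ∀ x, Measurable (q x) := fun x => (hhm x).neg.max measurable_const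
  have hp0 : ∀ x z, 0 ≤ p x z := fun x z => le_max_right _ _
  have hq0 : ∀ x z, 0 ≤ q x z := fun x z => le_max_right _ _
  have hpB : ∀ x z, p x z ≤ L.card := fun x z =>
    max_le ((le_abs_self _).trans (hhB x z)) (Nat.cast_nonneg _)
  have hqB : ∀ x z, q x z ≤ L.card := fun x z =>
    max_le ((neg_le_abs _).trans (hhB x z)) (Nat.cast_nonneg _)
  have hpi : ∀ x (μ : Measure Z) [IsProbabilityMeasure μ], Integrable (p x) μ := fun x μ _ =>
    hint μ (hpm x) ⟨L.card, fun z => by rw [abs_of_nonneg (hp0 x z)]; exact hpB x z⟩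
  have hqi : ∀ x (μ : Measure Z) [IsProbabilityMeasure μ], Integrable (q x) μ := fun x μ _ =>
    hint μ (hqm x) ⟨L.card, fun z => by rw [abs_of_nonneg (hq0 x z)]; exact hqB x z⟩
  have hpq : ∀ x z, h x z = p x z - q x z := by
    intro x z
    have := max_zero_sub_eq_self (h x z)
    simp only [p, q]
    linarith
  have hpq' : ∀ x z, |h x z| = p x z + q x z := by
    intro x z
    simp only [p, q]
    rcases le_total 0 (h x z) with h0 | h0
    · rw [abs_of_nonneg h0, max_eq_left h0, max_eq_right (by linarith)]; ring
    · rw [abs_of_nonpos h0, max_eq_right h0, max_eq_left (by linarith)]; ring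
  have hLHS : ∑ ℓ ∈ L, ∑ x, parity ℓ x * ∫ z, ψ ℓ z ∂(M x) = ∑ x, ∫ z, h x z ∂(M x) := by
    rw [Finset.sum_comm]
    refine Finset.sum_congr rfl fun x _ => ?_
    rw [hh, integral_finsetSum]
    · refine Finset.sum_congr rfl fun ℓ _ => ?_
      rw [integral_mul_const, mul_comm]
    · intro ℓ _
      exact (hint _ (hψm ℓ) ⟨1, hψ ℓ⟩).mul_const _
  clear_value p q
  rw [hLHS]
  -- Privacy moves every `M x` to a common `M y`: the positive part grows by at most exp ε, the
  -- negative part shrinks by at most exp (-ε), and each costs δ times the bound on `h`.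
  have hcmp : ∀ x y, ∫ z, h x z ∂(M x) ≤
      ∫ z, (Real.exp ε * p x z - Real.exp (-ε) * q x z) ∂(M y) + 2 * δ * L.card := by
    intro x y
    have h1 := integral_le_of_forall_measure_le (Real.exp_pos ε).le hδ (hM x y) (hpm x) (hp0 x)
      (hpB x) (Nat.cast_nonneg _)
    have h2 := integral_le_of_forall_measure_le (Real.exp_pos ε).le hδ (hM y x) (hqm x) (hq0 x)
      (hqB x) (Nat.cast_nonneg _)
    simp_rw [hpq x]
    rw [integral_sub (hpi x _) (hqi x _), integral_sub ((hpi x _).const_mul _)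
      ((hqi x _).const_mul _), integral_const_mul, integral_const_mul]
    have h3 : Real.exp (-ε) * ∫ z, q x z ∂(M y) ≤ ∫ z, q x z ∂(M x) + δ * L.card := by
      have h4 := mul_le_mul_of_nonneg_left h2 (Real.exp_pos (-ε)).le
      have h5 : Real.exp (-ε) * Real.exp ε = 1 := by rw [← Real.exp_add]; simp
      have h6 : Real.exp (-ε) ≤ 1 := by simpa using hε
      have h7 : Real.exp (-ε) * (δ * L.card) ≤ δ * L.card :=
        mul_le_of_le_one_left (by positivity) h6
      calc _ ≤ _ := h4
        _ = (Real.exp (-ε) * Real.exp ε) * ∫ z, q x z ∂(M x) + Real.exp (-ε) * (δ * L.card) := by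
          ring
        _ ≤ _ := by rw [h5, one_mul]; linarith
    linarith
  have hy : ∀ _ : Cube d, ∑ x, ∫ z, h x z ∂(M x) ≤
      2 ^ d * (Real.sinh ε * √(L.card : ℝ) + 2 * δ * L.card) := by
    intro y
    refine (Finset.sum_le_sum fun x _ => hcmp x y).trans ?_
    rw [Finset.sum_add_distrib, ← integral_finsetSum]
    · rw [Finset.sum_const, Finset.card_univ, nsmul_eq_mul, card_cube, mul_add]
      gcongr
      have hpt : ∀ z, ∑ x, (Real.exp ε * p x z - Real.exp (-ε) * q x z) ≤
          2 ^ d * (Real.sinh ε * √(L.card : ℝ)) := by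
        intro z
        have h1 := hsum0 z
        have h2 := sum_abs_sum_mul_parity_le L (fun ℓ => ψ ℓ z) (fun ℓ => hψ ℓ z)
        change ∑ x, |h x z| ≤ _ at h2
        rw [Finset.sum_congr rfl fun x _ => hpq x z] at h1
        rw [Finset.sum_congr rfl fun x _ => hpq' x z] at h2
        rw [Finset.sum_sub_distrib] at h1
        rw [Finset.sum_add_distrib] at h2
        rw [Finset.sum_sub_distrib, ← Finset.mul_sum, ← Finset.mul_sum]
        -- The totals being equal, each is half of ∑ |h|, and (exp ε - exp (-ε)) / 2 is sinh ε.
        have h3 : ∑ x, q x z = ∑ x, p x z := by linarith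
        rw [h3] at h2 ⊢
        have h4 : Real.exp ε * ∑ x, p x z - Real.exp (-ε) * ∑ x, p x z =
            Real.sinh ε * (∑ x, p x z + ∑ x, p x z) := by
          rw [Real.sinh_eq]; ring
        rw [h4, mul_left_comm]
        exact mul_le_mul_of_nonneg_left h2 (Real.sinh_nonneg_iff.2 hε)
      refine (integral_mono ?_ (integrable_const _) hpt).trans (by simp)
      exact integrable_finsetSum _ fun x _ => ((hpi x _).const_mul _).sub ((hqi x _).const_mul _)
    · exact fun x _ => ((hpi x _).const_mul _).sub ((hqi x _).const_mul _)
  -- Any reference point of the cube would do.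
  exact hy 1

/-! ### Rearrangements of messages -/

namespace Messages

variable {Y : Type*}

/-- Two vectors of messages are equivalent if one is a rearrangement of the other. -/
def Equivalent (y y' : Messages Y) : Prop :=
  ∃ e : Fin y.1 ≃ Fin y'.1, ∀ i, y'.2 (e i) = y.2 i

theorem equivalent_permute (y : Messages Y) (σ : Equiv.Perm (Fin y.1)) :
    (y.permute σ).Equivalent y :=
  ⟨σ, fun _ => rfl⟩

theorem append_finSumFinEquiv {a b : ℕ} (u : Fin a → Y) (v : Fin b → Y) (s : Fin a ⊕ Fin b) :
    Fin.append u v (finSumFinEquiv s) = Sum.elim u v s := by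
  cases s <;> simp

theorem Equivalent.append {y y' z z' : Messages Y} (h : y.Equivalent y') (h' : z.Equivalent z') :
    (append (y, z)).Equivalent (append (y', z')) := by
  obtain ⟨e, he⟩ := h
  obtain ⟨e', he'⟩ := h'
  refine ⟨finSumFinEquiv.symm.trans ((Equiv.sumCongr e e').trans finSumFinEquiv), fun i => ?_⟩
  obtain ⟨s, rfl⟩ := finSumFinEquiv.surjective i
  change Fin.append y'.2 z'.2 (finSumFinEquiv
    (Equiv.sumCongr e e' (finSumFinEquiv.symm (finSumFinEquiv s)))) =
    Fin.append y.2 z.2 (finSumFinEquiv s)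
  rw [Equiv.symm_apply_apply, append_finSumFinEquiv, append_finSumFinEquiv]
  cases s <;> simp [he, he']

/-- The order in which two users contribute is invisible up to rearrangement; this is why the
operators of different users commute. -/
theorem equivalent_append_right_comm (y z z' : Messages Y) :
    (append (append (y, z), z')).Equivalent (append (append (y, z'), z)) := by
  have key : ∀ u v : Messages Y, ∃ e : Fin (Messages.append (Messages.append (y, u), v)).1 ≃
      (Fin y.1 ⊕ Fin u.1) ⊕ Fin v.1, ∀ s, (Messages.append (Messages.append (y, u), v)).2
        (e.symm s) = Sum.elim (Sum.elim y.2 u.2) v.2 s := by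
    intro u v
    refine ⟨finSumFinEquiv.symm.trans (Equiv.sumCongr finSumFinEquiv.symm (Equiv.refl _)),
      fun s => ?_⟩
    change Fin.append (Fin.append y.2 u.2) v.2 (finSumFinEquiv
      (Sum.map finSumFinEquiv id s)) = _
    rw [append_finSumFinEquiv]
    rcases s with (s | s) | s
    · exact append_finSumFinEquiv y.2 u.2 (Sum.inl s)
    · exact append_finSumFinEquiv y.2 u.2 (Sum.inr s)
    · rfl
  obtain ⟨e, he⟩ := key z z'
  obtain ⟨e', he'⟩ := key z' z
  refine ⟨e.trans (((Equiv.sumAssoc _ _ _).trans ((Equiv.sumCongr (Equiv.refl _)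
    (Equiv.sumComm _ _)).trans (Equiv.sumAssoc _ _ _).symm)).trans e'.symm), fun i => ?_⟩
  obtain ⟨s, rfl⟩ := e.symm.surjective i
  rw [he, Equiv.trans_apply, Equiv.apply_symm_apply, Equiv.trans_apply, he']
  rcases s with (s | s) | s <;> rfl

end Messages

/-! ### Tests invariant under rearrangement -/

section Invariant

variable {W Y : Type*} [MeasurableSpace W] [MeasurableSpace Y]

theorem integrable_of_abs_le {Z : Type*} [MeasurableSpace Z] {μ : Measure Z} [IsFiniteMeasure μ]
    {f : Z → ℝ} (hf : Measurable f) {B : ℝ} (hB : ∀ z, |f z| ≤ B) : Integrable f μ :=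
  Integrable.of_bound hf.aestronglyMeasurable B
    (Filter.Eventually.of_forall fun z => by simpa using hB z)

variable (W Y) in
/-- The bounded measurable tests of the public randomness and the messages that do not depend on
the order of the messages. -/
def invariantTests : Submodule ℝ (W × Messages Y → ℝ) where
  carrier := {ψ | Measurable ψ ∧ (∃ B, ∀ p, |ψ p| ≤ B) ∧
    ∀ w y y', Messages.Equivalent y y' → ψ (w, y) = ψ (w, y')}
  add_mem' := by
    rintro f g ⟨hf, ⟨B, hB⟩, hfe⟩ ⟨hg, ⟨B', hB'⟩, hge⟩
    refine ⟨hf.add hg, ⟨B + B', fun p => (abs_add_le _ _).trans (add_le_add (hB p) (hB' p))⟩, ?_⟩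
    intro w y y' h
    simp [hfe w y y' h, hge w y y' h]
  zero_mem' := ⟨measurable_const, ⟨0, by simp⟩, by simp⟩
  smul_mem' := by
    rintro c f ⟨hf, ⟨B, hB⟩, hfe⟩
    refine ⟨hf.const_smul c, ⟨|c| * B, fun p => ?_⟩, ?_⟩
    · simp only [Pi.smul_apply, smul_eq_mul, abs_mul]
      exact mul_le_mul_of_nonneg_left (hB p) (abs_nonneg _)
    · intro w y y' h
      simp [hfe w y y' h]

namespace invariantTests

variable (ψ : invariantTests W Y)

theorem measurable : Measurable ψ.1 := ψ.2.1

theorem bounded : ∃ B, ∀ p, |ψ.1 p| ≤ B := ψ.2.2.1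

theorem eq_of_equivalent (w : W) {y y' : Messages Y} (h : y.Equivalent y') :
    ψ.1 (w, y) = ψ.1 (w, y') := ψ.2.2.2 w y y' h

theorem integrable (μ : Measure (W × Messages Y)) [IsFiniteMeasure μ] : Integrable ψ.1 μ :=
  integrable_of_abs_le (measurable ψ) (bounded ψ).choose_spec

theorem integral_shuffler (w : W) (y : Messages Y) :
    ∫ z, ψ.1 (w, z) ∂shuffler Y y = ψ.1 (w, y) := by
  have hm : Measurable fun z => ψ.1 (w, z) := (measurable ψ).comp (by fun_prop)
  have h0 : ((y.1 ! : ℕ) : ℝ) ≠ 0 := by exact_mod_cast Nat.factorial_ne_zero _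
  change ∫ z, ψ.1 (w, z) ∂(((y.1 ! : ℕ) : ℝ≥0∞)⁻¹ •
    ∑ σ : Equiv.Perm (Fin y.1), Measure.dirac (y.permute σ)) = _
  rw [integral_smul_measure, integral_finsetSum_measure]
  · simp_rw [integral_dirac' _ _ hm.stronglyMeasurable,
      eq_of_equivalent ψ w (Messages.equivalent_permute y _)]
    simp [Fintype.card_perm, h0]
  · exact fun σ _ => integrable_of_abs_le hm fun z => (bounded ψ).choose_spec (w, z)

end invariantTests

/-- The average of a bounded measurable test over all rearrangements of the messages. -/
noncomputable def symmetrize (g : W × Messages Y → ℝ) (hg : Measurable g) (B : ℝ)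
    (hB : ∀ p, |g p| ≤ B) : invariantTests W Y := by
  refine ⟨fun p => ∫ z, g (p.1, z) ∂shuffler Y p.2, ?_, ⟨B, fun p => ?_⟩, ?_⟩
  · refine (StronglyMeasurable.integral_kernel_prod_right'
      (κ := (shuffler Y).comap (Prod.snd : W × Messages Y → _) measurable_snd)
      (f := fun q : (W × Messages Y) × Messages Y => g (q.1.1, q.2)) ?_).measurable
    exact (hg.comp (by fun_prop)).stronglyMeasurable
  · refine (norm_integral_le_of_norm_le_const (C := B)
      (Filter.Eventually.of_forall fun z => (Real.norm_eq_abs _).trans_le (hB (p.1, z)))).trans ?_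
    simp
  · rintro w ⟨a, y⟩ ⟨b, y'⟩ ⟨e, he⟩
    obtain rfl : a = b := by simpa using Fintype.card_congr e
    have hm : Measurable fun z => g (w, z) := hg.comp (by fun_prop)
    change ∫ z, g (w, z) ∂(((a ! : ℕ) : ℝ≥0∞)⁻¹ •
        ∑ σ : Equiv.Perm (Fin a), Measure.dirac (Messages.permute ⟨a, y⟩ σ)) =
      ∫ z, g (w, z) ∂(((a ! : ℕ) : ℝ≥0∞)⁻¹ •
        ∑ σ : Equiv.Perm (Fin a), Measure.dirac (Messages.permute ⟨a, y'⟩ σ))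
    congr 2
    -- Composing with the rearrangement `e` only reindexes the sum over permutations.
    refine Fintype.sum_equiv (Equiv.mulLeft e) _ _ fun σ => ?_
    congr 1
    simp only [Messages.permute, Equiv.coe_mulLeft]
    congr 1
    funext i
    exact (he (σ i)).symm

end Invariant

/-! ### Users as commuting operators on tests -/

namespace ShuffleProtocol

variable {n : ℕ} {X Y W O : Type*} [MeasurableSpace X] [MeasurableSpace Y] [MeasurableSpace W]
  [MeasurableSpace O]

/-- The effect on a test of adding the messages of one user with data `x`. -/
noncomputable def addUser (Q : ShuffleProtocol n X Y W O) (x : X) :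
    Module.End ℝ (invariantTests W Y) where
  toFun ψ := by
    refine ⟨fun p => ∫ z, ψ.1 (p.1, Messages.append (p.2, z)) ∂Q.randomizer (p.1, x),
      ?_, ⟨(invariantTests.bounded ψ).choose, fun p => ?_⟩, ?_⟩
    · refine (StronglyMeasurable.integral_kernel_prod_right'
        (κ := Q.randomizer.comap (fun p : W × Messages Y => (p.1, x)) (by fun_prop))
        (f := fun q : (W × Messages Y) × Messages Y =>
          ψ.1 (q.1.1, Messages.append (q.1.2, q.2))) ?_).measurable
      refine ((invariantTests.measurable ψ).comp (Measurable.prodMk (by fun_prop) ?_)).stronglyMeasurable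
      exact Messages.measurable_append.comp (by fun_prop)
    · refine (norm_integral_le_of_norm_le_const (C := (invariantTests.bounded ψ).choose)
        (Filter.Eventually.of_forall fun z =>
          (Real.norm_eq_abs _).trans_le
            ((invariantTests.bounded ψ).choose_spec (p.1, Messages.append (p.2, z))))).trans ?_
      simp
    · intro w y y' h
      exact integral_congr_ae (Filter.Eventually.of_forall fun z =>
        invariantTests.eq_of_equivalent ψ w (h.append ⟨Equiv.refl _, fun _ => rfl⟩))
  map_add' ψ ψ' := by
    ext p
    refine integral_add ?_ ?_
    · refine integrable_of_abs_le ?_ (fun z =>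
        (invariantTests.bounded ψ).choose_spec (p.1, Messages.append (p.2, z)))
      exact (invariantTests.measurable ψ).comp (Measurable.prodMk measurable_const
        (Messages.measurable_append.comp (by fun_prop)))
    · refine integrable_of_abs_le ?_ (fun z =>
        (invariantTests.bounded ψ').choose_spec (p.1, Messages.append (p.2, z)))
      exact (invariantTests.measurable ψ').comp (Measurable.prodMk measurable_const
        (Messages.measurable_append.comp (by fun_prop)))
  map_smul' c ψ := by
    ext p
    exact integral_const_mul _ _

theorem addUser_apply (Q : ShuffleProtocol n X Y W O) (x : X) (ψ : invariantTests W Y)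
    (p : W × Messages Y) : (Q.addUser x ψ).1 p =
      ∫ z, ψ.1 (p.1, Messages.append (p.2, z)) ∂Q.randomizer (p.1, x) := rfl

/-- Once the public randomness is fixed, users are independent, so Fubini exchanges them and
invariance of the test hides the order. -/
theorem addUser_commute (Q : ShuffleProtocol n X Y W O) (x x' : X) :
    Commute (Q.addUser x) (Q.addUser x') := by
  refine LinearMap.ext fun ψ => Subtype.ext (funext fun p => ?_)
  obtain ⟨w, y⟩ := p
  change ∫ z, ∫ z', ψ.1 (w, Messages.append (Messages.append (y, z), z')) ∂Q.randomizer (w, x')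
      ∂Q.randomizer (w, x) =
    ∫ z, ∫ z', ψ.1 (w, Messages.append (Messages.append (y, z), z')) ∂Q.randomizer (w, x)
      ∂Q.randomizer (w, x')
  rw [integral_integral_swap]
  · simp_rw [invariantTests.eq_of_equivalent ψ w
      (Messages.equivalent_append_right_comm y _ _)]
  · refine integrable_of_abs_le ?_ (B := (invariantTests.bounded ψ).choose) fun z =>
      (invariantTests.bounded ψ).choose_spec _
    refine (invariantTests.measurable ψ).comp (Measurable.prodMk measurable_const
      (Messages.measurable_append.comp (Measurable.prodMk
        (Messages.measurable_append.comp (by fun_prop)) (by fun_prop))))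

end ShuffleProtocol

theorem sum_ofReal_prod {X : Type*} [Fintype X] {μ : X → ℝ} (hμ : ∀ x, 0 ≤ μ x) (hμ1 : ∑ x, μ x = 1) (m : ℕ) :
    ∑ x : Fin m → X, ENNReal.ofReal (∏ i, μ (x i)) = 1 := by
  rw [← ENNReal.ofReal_sum_of_nonneg fun x _ => Finset.prod_nonneg fun i _ => hμ _,
    ← Fintype.prod_sum (fun (_ : Fin m) a => μ a)]
  simp [hμ1]

namespace ShuffleProtocol

/-! ### Expectations of tests under the view -/

section View

variable {n : ℕ} {X Y W O : Type*} [MeasurableSpace X] [MeasurableSpace Y] [MeasurableSpace W]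
  [MeasurableSpace O] (Q : ShuffleProtocol n X Y W O)

instance isProbabilityMeasure_view (m : ℕ) (x : Fin m → X) :
    IsProbabilityMeasure (Q.view m x) := by
  unfold view
  infer_instance

theorem integral_view_eq {g : W × Messages Y → ℝ} (hg : Measurable g) {B : ℝ}
    (hB : ∀ p, |g p| ≤ B) (m : ℕ) (x : Fin m → X) :
    ∫ p, g p ∂Q.view m x =
      ∫ w, ∫ y, ∫ z, g (w, z) ∂shuffler Y y ∂Q.messages m (w, x) ∂Q.coins := by
  rw [view, Measure.integral_compProd (integrable_of_abs_le hg hB)]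
  refine integral_congr_ae (Filter.Eventually.of_forall fun w => ?_)
  simp only [Kernel.comap_apply]
  rw [Kernel.integral_comp]
  exact integrable_of_abs_le (hg.comp (by fun_prop)) fun z => hB (w, z)

theorem integral_view (m : ℕ) (x : Fin m → X) (ψ : invariantTests W Y) :
    ∫ p, ψ.1 p ∂Q.view m x = ∫ w, ∫ y, ψ.1 (w, y) ∂Q.messages m (w, x) ∂Q.coins := by
  rw [Q.integral_view_eq (invariantTests.measurable ψ) (invariantTests.bounded ψ).choose_spec]
  simp_rw [invariantTests.integral_shuffler]

theorem integral_view_symmetrize {g : W × Messages Y → ℝ} (hg : Measurable g) {B : ℝ}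
    (hB : ∀ p, |g p| ≤ B) (m : ℕ) (x : Fin m → X) :
    ∫ p, (symmetrize g hg B hB).1 p ∂Q.view m x = ∫ p, g p ∂Q.view m x := by
  rw [integral_view, Q.integral_view_eq hg hB]
  rfl

theorem integral_view_succ (m : ℕ) (x : Fin (m + 1) → X) (ψ : invariantTests W Y) :
    ∫ p, ψ.1 p ∂Q.view (m + 1) x =
      ∫ p, (Q.addUser (x (Fin.last m)) ψ).1 p ∂Q.view m (fun i => x i.castSucc) := by
  rw [integral_view, integral_view]
  refine integral_congr_ae (Filter.Eventually.of_forall fun w => ?_)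
  have hm : Measurable fun y => ψ.1 (w, y) := (invariantTests.measurable ψ).comp (by fun_prop)
  simp only [messages, Q.addUser_apply]
  rw [Kernel.map_apply _ Messages.measurable_append,
    integral_map Messages.measurable_append.aemeasurable hm.aestronglyMeasurable,
    Kernel.prod_apply, Kernel.comap_apply, Kernel.comap_apply, integral_prod]
  exact integrable_of_abs_le (hm.comp Messages.measurable_append) fun z =>
    (invariantTests.bounded ψ).choose_spec _

/-- The mean of a test when there are no users. -/
noncomputable def meanEmpty : invariantTests W Y →ₗ[ℝ] ℝ where
  toFun ψ := ∫ w, ψ.1 (w, Messages.empty) ∂Q.coins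
  map_add' ψ ψ' := integral_add
    (integrable_of_abs_le ((invariantTests.measurable ψ).comp (by fun_prop))
      fun w => (invariantTests.bounded ψ).choose_spec (w, Messages.empty))
    (integrable_of_abs_le ((invariantTests.measurable ψ').comp (by fun_prop))
      fun w => (invariantTests.bounded ψ').choose_spec (w, Messages.empty))
  map_smul' c ψ := integral_const_mul _ _

theorem integral_view_zero (x : Fin 0 → X) (ψ : invariantTests W Y) :
    ∫ p, ψ.1 p ∂Q.view 0 x = Q.meanEmpty ψ := by
  rw [integral_view]
  refine integral_congr_ae (Filter.Eventually.of_forall fun w => ?_)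
  have hm : Measurable fun y => ψ.1 (w, y) := (invariantTests.measurable ψ).comp (by fun_prop)
  simp only [messages, Kernel.const_apply]
  rw [integral_dirac' _ _ hm.stronglyMeasurable]

theorem abs_meanEmpty_le {ψ : invariantTests W Y} {B : ℝ} (hB : ∀ p, |ψ.1 p| ≤ B) :
    |Q.meanEmpty ψ| ≤ B := by
  refine (norm_integral_le_of_norm_le_const (C := B) (Filter.Eventually.of_forall fun w =>
    (Real.norm_eq_abs _).trans_le (hB (w, Messages.empty)))).trans ?_
  simp

theorem meanEmpty_nonneg {ψ : invariantTests W Y} (h : ∀ p, 0 ≤ ψ.1 p) : 0 ≤ Q.meanEmpty ψ :=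
  integral_nonneg fun w => h (w, Messages.empty)

theorem abs_addUser_le {ψ : invariantTests W Y} {B : ℝ} (hB : ∀ p, |ψ.1 p| ≤ B) (x : X)
    (p : W × Messages Y) : |(Q.addUser x ψ).1 p| ≤ B := by
  refine (norm_integral_le_of_norm_le_const (C := B) (Filter.Eventually.of_forall fun z =>
    (Real.norm_eq_abs _).trans_le (hB (p.1, Messages.append (p.2, z))))).trans ?_
  simp

theorem addUser_nonneg {ψ : invariantTests W Y} (h : ∀ p, 0 ≤ ψ.1 p) (x : X)
    (p : W × Messages Y) : 0 ≤ (Q.addUser x ψ).1 p :=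
  integral_nonneg fun z => h (p.1, Messages.append (p.2, z))

end View

/-! ### Users with random data -/

section Mix

variable {n : ℕ} {X Y W O : Type*} [Fintype X] [MeasurableSpace X] [MeasurableSpace Y]
  [MeasurableSpace W] [MeasurableSpace O] (Q : ShuffleProtocol n X Y W O)

/-- The effect on a test of adding the messages of one user, averaged over the data of the user
with weights `μ`. -/
noncomputable def mixUser (μ : X → ℝ) : Module.End ℝ (invariantTests W Y) :=
  ∑ x, μ x • Q.addUser x

theorem mixUser_apply (μ : X → ℝ) (ψ : invariantTests W Y) :
    Q.mixUser μ ψ = ∑ x, μ x • Q.addUser x ψ := by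
  simp [mixUser, LinearMap.sum_apply]

theorem mixUser_add (μ ν : X → ℝ) : Q.mixUser (μ + ν) = Q.mixUser μ + Q.mixUser ν := by
  simp [mixUser, add_smul, Finset.sum_add_distrib]

theorem mixUser_smul (c : ℝ) (μ : X → ℝ) : Q.mixUser (c • μ) = c • Q.mixUser μ := by
  simp [mixUser, Finset.smul_sum, mul_smul]

theorem mixUser_commute (μ ν : X → ℝ) : Commute (Q.mixUser μ) (Q.mixUser ν) :=
  Commute.sum_left _ _ _ fun x _ => Commute.sum_right _ _ _ fun y _ =>
    ((Q.addUser_commute x y).smul_left _).smul_right _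

theorem mixUser_val (μ : X → ℝ) (ψ : invariantTests W Y) (p : W × Messages Y) :
    (Q.mixUser μ ψ).1 p = ∑ x, μ x * (Q.addUser x ψ).1 p := by
  rw [mixUser_apply]
  simp

theorem mixUser_nonneg {μ : X → ℝ} (hμ : ∀ x, 0 ≤ μ x) {ψ : invariantTests W Y}
    (h : ∀ p, 0 ≤ ψ.1 p) (p : W × Messages Y) : 0 ≤ (Q.mixUser μ ψ).1 p := by
  rw [mixUser_val]
  exact Finset.sum_nonneg fun x _ => mul_nonneg (hμ x) (Q.addUser_nonneg h x p)

theorem abs_mixUser_le {μ : X → ℝ} (hμ : ∀ x, 0 ≤ μ x) (hμ1 : ∑ x, μ x = 1)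
    {ψ : invariantTests W Y} {B : ℝ} (hB : ∀ p, |ψ.1 p| ≤ B) (p : W × Messages Y) :
    |(Q.mixUser μ ψ).1 p| ≤ B := by
  rw [mixUser_val]
  refine (Finset.abs_sum_le_sum_abs _ _).trans ?_
  calc ∑ x, |μ x * (Q.addUser x ψ).1 p| ≤ ∑ x, μ x * B := by
        refine Finset.sum_le_sum fun x _ => ?_
        rw [abs_mul, abs_of_nonneg (hμ x)]
        exact mul_le_mul_of_nonneg_left (Q.abs_addUser_le hB x p) (hμ x)
    _ = B := by rw [← Finset.sum_mul, hμ1, one_mul]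

theorem mixUser_pow_nonneg {μ : X → ℝ} (hμ : ∀ x, 0 ≤ μ x) {ψ : invariantTests W Y}
    (h : ∀ p, 0 ≤ ψ.1 p) (r : ℕ) : ∀ p, 0 ≤ ((Q.mixUser μ ^ r) ψ).1 p := by
  induction r with
  | zero => simpa using h
  | succ r ih => rw [pow_succ']; exact Q.mixUser_nonneg hμ ih

theorem abs_mixUser_pow_le {μ : X → ℝ} (hμ : ∀ x, 0 ≤ μ x) (hμ1 : ∑ x, μ x = 1)
    {ψ : invariantTests W Y} {B : ℝ} (hB : ∀ p, |ψ.1 p| ≤ B) (r : ℕ) :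
    ∀ p, |((Q.mixUser μ ^ r) ψ).1 p| ≤ B := by
  induction r with
  | zero => simpa using hB
  | succ r ih => rw [pow_succ']; exact Q.abs_mixUser_le hμ hμ1 ih

/-- Users with independent data drawn with weights `μ`. -/
theorem sum_prod_mul_integral_view (μ : X → ℝ) (m : ℕ) (ψ : invariantTests W Y) :
    ∑ x : Fin m → X, (∏ i, μ (x i)) * ∫ p, ψ.1 p ∂Q.view m x =
      Q.meanEmpty ((Q.mixUser μ ^ m) ψ) := by
  induction m generalizing ψ with
  | zero => simp [integral_view_zero]
  | succ m ih =>
    rw [pow_succ, Module.End.mul_apply, mixUser_apply, map_sum, map_sum,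
      ← (Fin.snocEquiv fun _ => X).sum_comp, Fintype.sum_prod_type]
    refine Finset.sum_congr rfl fun a _ => ?_
    rw [map_smul, map_smul, ← ih, smul_eq_mul, Finset.mul_sum]
    refine Finset.sum_congr rfl fun x _ => ?_
    rw [integral_view_succ, Fin.prod_univ_castSucc]
    simp only [Fin.snocEquiv_apply, Fin.snoc_last, Fin.snoc_castSucc]
    ring

/-- The law of the view when a user with data `a` joins `m` users with independent data drawn with
weights `μ`. -/
noncomputable def viewWith (μ : X → ℝ) (m : ℕ) (a : X) : Measure (W × Messages Y) :=
  ∑ x : Fin m → X, ENNReal.ofReal (∏ i, μ (x i)) •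
    Q.view (m + 1) (Fin.snoc (α := fun _ => X) x a)

theorem isProbabilityMeasure_viewWith {μ : X → ℝ} (hμ : ∀ x, 0 ≤ μ x) (hμ1 : ∑ x, μ x = 1)
    (m : ℕ) (a : X) : IsProbabilityMeasure (Q.viewWith μ m a) := by
  constructor
  simp [viewWith, Measure.finsetSum_apply, sum_ofReal_prod hμ hμ1]

theorem integral_viewWith {μ : X → ℝ} (hμ : ∀ x, 0 ≤ μ x) (m : ℕ) (a : X)
    (ψ : invariantTests W Y) :
    ∫ p, ψ.1 p ∂Q.viewWith μ m a = Q.meanEmpty ((Q.mixUser μ ^ m) (Q.addUser a ψ)) := by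
  rw [viewWith, integral_finsetSum_measure]
  · rw [← sum_prod_mul_integral_view]
    refine Finset.sum_congr rfl fun x _ => ?_
    rw [integral_smul_measure, integral_view_succ, smul_eq_mul,
      ENNReal.toReal_ofReal (Finset.prod_nonneg fun i _ => hμ _)]
    simp only [Fin.snoc_last, Fin.snoc_castSucc]
  · exact fun x _ => (invariantTests.integrable ψ _).smul_measure ENNReal.ofReal_ne_top

/-- Privacy holds for each fixed choice of the other users' data, and averaging preserves it because
the weights sum to 1. -/
theorem viewWith_le {ε δ : ℝ} {m : ℕ} (hQ : IsDifferentiallyPrivate ε δ (Q.view (m + 1)))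
    {μ : X → ℝ} (hμ : ∀ x, 0 ≤ μ x) (hμ1 : ∑ x, μ x = 1) (a a' : X) {S : Set (W × Messages Y)}
    (hS : MeasurableSet S) :
    Q.viewWith μ m a S ≤
      ENNReal.ofReal (Real.exp ε) * Q.viewWith μ m a' S + ENNReal.ofReal δ := by
  simp only [viewWith, Measure.finsetSum_apply, Measure.smul_apply, smul_eq_mul]
  calc _ ≤ ∑ x : Fin m → X, ENNReal.ofReal (∏ i, μ (x i)) *
        (ENNReal.ofReal (Real.exp ε) * Q.view (m + 1) (Fin.snoc (α := fun _ => X) x a') S +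
          ENNReal.ofReal δ) := by
        refine Finset.sum_le_sum fun x _ => mul_le_mul_right ?_ _
        refine hQ _ _ ?_ S hS
        have hlast : ∀ i, Fin.snoc (α := fun _ => X) x a i ≠ Fin.snoc (α := fun _ => X) x a' i →
            i = Fin.last m := by
          intro i
          refine Fin.lastCases (fun _ => rfl) (fun j h => ?_) i
          simp at h
        intro i hi j hj
        rw [hlast i hi, hlast j hj]
    _ = _ := by
        simp_rw [mul_add]
        rw [Finset.sum_add_distrib, ← Finset.sum_mul, sum_ofReal_prod hμ hμ1, one_mul,
          Finset.mul_sum]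
        simp_rw [mul_left_comm]

end Mix

end ShuffleProtocol

/-! ### Distributions on the cube with one biased parity -/

/-- The density of the distribution on the cube under which the parity `ℓ` has mean `β` and is
otherwise uniform. -/
noncomputable def biasedDensity {d : ℕ} (β : ℝ) (ℓ : Finset (Fin d)) (x : Cube d) : ℝ :=
  (2 ^ d)⁻¹ * (1 + β * parity ℓ x)

theorem biasedDensity_nonneg {d : ℕ} {β : ℝ} (hβ : |β| ≤ 1) (ℓ : Finset (Fin d)) (x : Cube d) :
    0 ≤ biasedDensity β ℓ x := by
  have h : |β * parity ℓ x| ≤ 1 := by rwa [abs_mul, abs_parity, mul_one]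
  have := (abs_le.1 h).1
  exact mul_nonneg (by positivity) (by linarith)

theorem sum_biasedDensity {d : ℕ} (β : ℝ) {ℓ : Finset (Fin d)} (hℓ : ℓ.Nonempty) :
    ∑ x, biasedDensity β ℓ x = 1 := by
  simp only [biasedDensity]
  rw [← Finset.mul_sum, Finset.sum_add_distrib, ← Finset.mul_sum, sum_parity hℓ]
  simp

theorem sum_biasedDensity_mul_parity {d : ℕ} (β : ℝ) {ℓ : Finset (Fin d)} (hℓ : ℓ.Nonempty) :
    ∑ x, biasedDensity β ℓ x * parity ℓ x = β := by
  have h : ∀ x : Cube d, biasedDensity β ℓ x * parity ℓ x =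
      (2 ^ d)⁻¹ * parity ℓ x + (2 ^ d)⁻¹ * β * (parity ℓ x * parity ℓ x) := by
    intro x
    simp only [biasedDensity]
    ring
  simp_rw [h]
  rw [Finset.sum_add_distrib, ← Finset.mul_sum, ← Finset.mul_sum, sum_parity hℓ,
    sum_parity_mul_parity, if_pos rfl]
  field_simp
  simp

/-- The distribution with density `biasedDensity`. -/
noncomputable def biasedMeasure {d : ℕ} (β : ℝ) (ℓ : Finset (Fin d)) : Measure (Cube d) :=
  ∑ x, ENNReal.ofReal (biasedDensity β ℓ x) • Measure.dirac x

theorem biasedMeasure_singleton {d : ℕ} (β : ℝ) (ℓ : Finset (Fin d)) (x : Cube d) :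
    biasedMeasure β ℓ {x} = ENNReal.ofReal (biasedDensity β ℓ x) := by
  simp [biasedMeasure, Measure.finsetSum_apply, Set.indicator]

theorem isProbabilityMeasure_biasedMeasure {d : ℕ} {β : ℝ} (hβ : |β| ≤ 1)
    {ℓ : Finset (Fin d)} (hℓ : ℓ.Nonempty) : IsProbabilityMeasure (biasedMeasure β ℓ) := by
  constructor
  simp only [biasedMeasure, Measure.finsetSum_apply, Measure.smul_apply, measure_univ, smul_eq_mul,
    mul_one]
  rw [← ENNReal.ofReal_sum_of_nonneg fun x _ => biasedDensity_nonneg hβ ℓ x,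
    sum_biasedDensity β hℓ, ENNReal.ofReal_one]

theorem integral_parity_biasedMeasure {d : ℕ} {β : ℝ} (hβ : |β| ≤ 1)
    {ℓ : Finset (Fin d)} (hℓ : ℓ.Nonempty) : ∫ z, parity ℓ z ∂biasedMeasure β ℓ = β := by
  have := isProbabilityMeasure_biasedMeasure hβ hℓ
  rw [integral_fintype Integrable.of_finite]
  simp only [measureReal_def, biasedMeasure_singleton, smul_eq_mul,
    ENNReal.toReal_ofReal (biasedDensity_nonneg hβ ℓ _)]
  exact sum_biasedDensity_mul_parity β hℓ

/-! ### Accuracy as distinguishing advantage -/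

theorem ReleasesParities.le_sum {d n k : ℕ} {α : ℝ}
    {M : (Fin n → Cube d) → Measure (Finset (Fin d) → ℝ)} [∀ x, IsProbabilityMeasure (M x)]
    (hM : ReleasesParities k α M) {β : ℝ} (hβ : |β| ≤ 1) {ℓ : Finset (Fin d)} (hℓ : ℓ.Nonempty)
    (hk : ℓ.card ≤ k) {T : Set (Finset (Fin d) → ℝ)} (hT : ∀ F, |F ℓ - β| ≤ α → F ∈ T) :
    99 / 100 ≤ ∑ x : Fin n → Cube d, (∏ i, biasedDensity β ℓ (x i)) * (M x).real T := by
  have := isProbabilityMeasure_biasedMeasure hβ hℓ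
  have h0 : ∀ x : Fin n → Cube d, 0 ≤ ∏ i, biasedDensity β ℓ (x i) := fun x =>
    Finset.prod_nonneg fun i _ => biasedDensity_nonneg hβ ℓ _
  have h1 : (99 / 100 : ℝ≥0∞) ≤
      ∫⁻ x, M x T ∂(Measure.pi fun _ : Fin n => biasedMeasure β ℓ) := by
    refine (hM (biasedMeasure β ℓ) inferInstance).trans (lintegral_mono fun x => ?_)
    refine measure_mono fun F hF => hT F ?_
    have := hF ℓ hk
    rwa [integral_parity_biasedMeasure hβ hℓ] at this
  rw [lintegral_fintype] at h1
  have h2 : ∑ x : Fin n → Cube d, M x T * (Measure.pi fun _ : Fin n => biasedMeasure β ℓ) {x} =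
      ENNReal.ofReal (∑ x : Fin n → Cube d,
        (∏ i, biasedDensity β ℓ (x i)) * (M x).real T) := by
    rw [ENNReal.ofReal_sum_of_nonneg fun x _ => mul_nonneg (h0 x) measureReal_nonneg]
    refine Finset.sum_congr rfl fun x _ => ?_
    rw [Measure.pi_singleton, ENNReal.ofReal_mul (h0 x),
      ENNReal.ofReal_prod_of_nonneg fun i _ => biasedDensity_nonneg hβ ℓ _,
      ofReal_measureReal, mul_comm]
    simp_rw [biasedMeasure_singleton]
  rw [h2, ENNReal.le_ofReal_iff_toReal_le (by simp [ENNReal.div_eq_top])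
    (Finset.sum_nonneg fun x _ => mul_nonneg (h0 x) measureReal_nonneg)] at h1
  simpa using h1

/-- The distinguishing advantage obtained from the estimate of one biased parity. -/
theorem ReleasesParities.le_sum_sub_sum {d n k : ℕ} {α : ℝ}
    {M : (Fin n → Cube d) → Measure (Finset (Fin d) → ℝ)} [∀ x, IsProbabilityMeasure (M x)]
    (hM : ReleasesParities k α M) {β : ℝ} (hβ : β ≤ 1) (hα0 : 0 ≤ α) (hα : α < β)
    {ℓ : Finset (Fin d)} (hℓ : ℓ.Nonempty) (hk : ℓ.card ≤ k) :
    98 / 100 ≤ ∑ x : Fin n → Cube d, (∏ i, biasedDensity β ℓ (x i)) * (M x).real {F | 0 < F ℓ} -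
      ∑ x : Fin n → Cube d, (∏ i, biasedDensity (-β) ℓ (x i)) * (M x).real {F | 0 < F ℓ} := by
  have hT : MeasurableSet {F : Finset (Fin d) → ℝ | 0 < F ℓ} :=
    measurableSet_lt measurable_const (measurable_pi_apply ℓ)
  have hβ' : |β| ≤ 1 := by rw [abs_of_nonneg (by linarith)]; exact hβ
  have h1 := hM.le_sum hβ' hℓ hk (T := {F | 0 < F ℓ}) fun F hF => by
    have := (abs_le.1 hF).1
    simp only [Set.mem_ofPred_eq]
    linarith
  -- Under bias -β an accurate estimate is negative, so the event has probability at most 1/100,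
  -- against at least 99/100 under bias β.
  have h2 := hM.le_sum (β := -β) (by rwa [abs_neg]) hℓ hk (T := {F | 0 < F ℓ}ᶜ) fun F hF => by
    have := (abs_le.1 hF).2
    simp only [Set.mem_compl_iff, Set.mem_ofPred_eq]
    linarith
  have h3 : ∑ x : Fin n → Cube d, ∏ i, biasedDensity (-β) ℓ (x i) = 1 := by
    rw [← Fintype.prod_sum (fun (_ : Fin n) a => biasedDensity (-β) ℓ a)]
    simp [sum_biasedDensity _ hℓ]
  simp_rw [probReal_compl_eq_one_sub hT, mul_sub, mul_one, Finset.sum_sub_distrib, h3] at h2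
  linarith

/-- The family of nonempty sets of size at most `k`. -/
def widthLE (d k : ℕ) : Finset (Finset (Fin d)) := {ℓ | ℓ.Nonempty ∧ ℓ.card ≤ k}

theorem card_widthLE (d k : ℕ) : (widthLE d k).card = chooseLE d k := by
  rw [chooseLE, Finset.card_eq_sum_card_fiberwise (f := Finset.card) (t := Finset.Icc 1 k)]
  · refine Finset.sum_congr rfl fun j hj => ?_
    rw [Finset.mem_Icc] at hj
    have : (widthLE d k).filter (fun ℓ => ℓ.card = j) = Finset.powersetCard j Finset.univ := by
      ext ℓ
      simp only [widthLE, Finset.mem_filter, Finset.mem_univ, true_and, Finset.mem_powersetCard,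
        Finset.subset_univ, ← Finset.card_pos]
      omega
    rw [this, Finset.card_powersetCard, Finset.card_univ, Fintype.card_fin]
  · intro ℓ hℓ
    simp only [widthLE, Finset.coe_filter, Finset.mem_univ, true_and, Set.mem_ofPred_eq,
      ← Finset.card_pos] at hℓ
    simp only [Finset.coe_Icc, Set.mem_Icc]
    exact hℓ

theorem le_chooseLE {d k : ℕ} (hk : 1 ≤ k) : d ≤ chooseLE d k := by
  calc d = d.choose 1 := (Nat.choose_one_right d).symm
    _ ≤ chooseLE d k := Finset.single_le_sum (f := fun j => d.choose j) (fun _ _ => Nat.zero_le _)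
      (Finset.mem_Icc.2 ⟨le_rfl, hk⟩)

namespace ShuffleProtocol

/-! ### The output as a test of the view -/

section Output

variable {n : ℕ} {X Y W O : Type*} [MeasurableSpace X] [MeasurableSpace Y] [MeasurableSpace W]
  [MeasurableSpace O] (Q : ShuffleProtocol n X Y W O)

instance isProbabilityMeasure_output (x : Fin n → X) : IsProbabilityMeasure (Q.output x) := by
  constructor
  rw [output, Measure.bind_apply MeasurableSet.univ (Kernel.aemeasurable _)]
  simp

theorem measurable_analyzer_real {T : Set O} (hT : MeasurableSet T) :
    Measurable fun p => (Q.analyzer p).real T :=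
  (Kernel.measurable_coe _ hT).ennreal_toReal

/-- The probability that the output of the analyzer on the messages, once shuffled, lies in `T`. -/
noncomputable def outputTest {T : Set O} (hT : MeasurableSet T) : invariantTests W Y :=
  symmetrize (fun p => (Q.analyzer p).real T) (Q.measurable_analyzer_real hT) 1
    fun p => by rw [abs_of_nonneg measureReal_nonneg]; exact measureReal_le_one

theorem outputTest_nonneg {T : Set O} (hT : MeasurableSet T) (p : W × Messages Y) :
    0 ≤ (Q.outputTest hT).1 p :=
  integral_nonneg fun _ => measureReal_nonneg

theorem outputTest_le_one {T : Set O} (hT : MeasurableSet T) (p : W × Messages Y) :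
    |(Q.outputTest hT).1 p| ≤ 1 := by
  refine (norm_integral_le_of_norm_le_const (μ := shuffler Y p.2) (C := 1)
    (f := fun z => (Q.analyzer (p.1, z)).real T) (Filter.Eventually.of_forall fun z => ?_)).trans ?_
  · rw [Real.norm_eq_abs, abs_of_nonneg measureReal_nonneg]
    exact measureReal_le_one
  · simp

theorem output_real {T : Set O} (hT : MeasurableSet T) (x : Fin n → X) :
    (Q.output x).real T = ∫ p, (Q.outputTest hT).1 p ∂Q.view n x := by
  rw [outputTest, integral_view_symmetrize, measureReal_def, output,
    Measure.bind_apply hT (Kernel.aemeasurable _)]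
  simp only [measureReal_def]
  rw [integral_toReal (Kernel.measurable_coe _ hT).aemeasurable]
  exact Filter.Eventually.of_forall fun p => measure_lt_top _ _

end Output

/-! ### The hybrid argument -/

section Parities

variable {n d : ℕ} {Y W O : Type*} [MeasurableSpace Y] [MeasurableSpace W] [MeasurableSpace O]
  (Q : ShuffleProtocol n (Cube d) Y W O)

/-- The effect on a test of adding one user with uniform data. -/
noncomputable def uniformUser : Module.End ℝ (invariantTests W Y) :=
  Q.mixUser fun _ => (2 ^ d)⁻¹

/-- The correlation of the effect of adding one user with the parity `ℓ` of the data. -/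
noncomputable def parityUser (ℓ : Finset (Fin d)) : Module.End ℝ (invariantTests W Y) :=
  Q.mixUser fun x => (2 ^ d)⁻¹ * parity ℓ x

/-- The effect on a test of adding one user whose data has one biased parity. -/
noncomputable def biasedUser (β : ℝ) (ℓ : Finset (Fin d)) : Module.End ℝ (invariantTests W Y) :=
  Q.mixUser (biasedDensity β ℓ)

theorem biasedUser_eq (β : ℝ) (ℓ : Finset (Fin d)) :
    Q.biasedUser β ℓ = Q.uniformUser + β • Q.parityUser ℓ := by
  rw [biasedUser, uniformUser, parityUser, ← mixUser_smul, ← mixUser_add]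
  congr 1
  funext x
  simp only [biasedDensity, Pi.add_apply, Pi.smul_apply, smul_eq_mul]
  ring

/-- Halving the bias amounts to a fair coin between bias β and uniform data; it supplies the uniform
users that the hybrid argument needs. -/
theorem biasedUser_half (β : ℝ) (ℓ : Finset (Fin d)) :
    Q.biasedUser (β / 2) ℓ = (1 / 2 : ℝ) • (Q.biasedUser β ℓ + Q.uniformUser) := by
  rw [biasedUser_eq, biasedUser_eq]
  module

/-- The private function of one point is the view of `m` uniform users and one user holding that
point. Whatever else depends on ℓ is put into the test `ψ ℓ`. -/
theorem sum_meanEmpty_parityUser_le {ε δ : ℝ} (hε : 0 ≤ ε) (hδ : 0 ≤ δ) {m : ℕ}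
    (hQ : IsDifferentiallyPrivate ε δ (Q.view (m + 1)))
    (L : Finset (Finset (Fin d))) (hL : ∀ ℓ ∈ L, ℓ.Nonempty)
    (ψ : Finset (Fin d) → invariantTests W Y) (hψ : ∀ ℓ p, |(ψ ℓ).1 p| ≤ 1) :
    ∑ ℓ ∈ L, Q.meanEmpty ((Q.uniformUser ^ m) (Q.parityUser ℓ (ψ ℓ))) ≤
      Real.sinh ε * √(L.card : ℝ) + 2 * δ * L.card := by
  have hu : ∀ x : Cube d, (0 : ℝ) ≤ (fun _ => (2 ^ d)⁻¹) x := fun x => by positivity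
  have hu1 : ∑ x : Cube d, (fun _ => ((2 : ℝ) ^ d)⁻¹) x = 1 := by
    rw [Finset.sum_const, Finset.card_univ, nsmul_eq_mul, card_cube]
    exact mul_inv_cancel₀ (by positivity)
  have := fun a => Q.isProbabilityMeasure_viewWith hu hu1 m a
  have h := sum_integral_parity_le hδ hε (Q.viewWith (fun _ => (2 ^ d)⁻¹) m)
    (fun x x' C hC => Q.viewWith_le hQ hu hu1 x x' hC) L hL (fun ℓ => (ψ ℓ).1)
    (fun ℓ => invariantTests.measurable (ψ ℓ)) hψ
  simp_rw [Q.integral_viewWith hu] at h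
  have h2 : ∀ ℓ, Q.meanEmpty ((Q.uniformUser ^ m) (Q.parityUser ℓ (ψ ℓ))) =
      (2 ^ d)⁻¹ * ∑ x, parity ℓ x *
        Q.meanEmpty ((Q.mixUser (fun _ => (2 ^ d)⁻¹) ^ m) (Q.addUser x (ψ ℓ))) := by
    intro ℓ
    rw [parityUser, mixUser_apply, map_sum, map_sum, Finset.mul_sum]
    refine Finset.sum_congr rfl fun x _ => ?_
    rw [map_smul, map_smul, smul_eq_mul, mul_assoc]
    rfl
  simp_rw [h2]
  rw [← Finset.mul_sum]
  rw [← inv_mul_le_iff₀ (by positivity)] at h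
  exact h

/-- Replacing `r` uniform users by biased ones, in the presence of at least `s` uniform users. -/
theorem sum_meanEmpty_biasedUser_pow_le {ε δ β σ : ℝ} (hε : 0 ≤ ε) (hδ : 0 ≤ δ) (hβ : 0 ≤ β)
    (hβ1 : β ≤ 1) (hσ : σ = 1 ∨ σ = -1)
    (L : Finset (Finset (Fin d))) (hL : ∀ ℓ ∈ L, ℓ.Nonempty)
    (ψ : Finset (Fin d) → invariantTests W Y) (hψ : ∀ ℓ p, |(ψ ℓ).1 p| ≤ 1) (r s : ℕ)
    (hQ : ∀ m, s ≤ m → IsDifferentiallyPrivate ε δ (Q.view (m + 1))) :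
    ∑ ℓ ∈ L, σ * (Q.meanEmpty ((Q.uniformUser ^ s) ((Q.biasedUser (β * σ) ℓ ^ r) (ψ ℓ))) -
      Q.meanEmpty ((Q.uniformUser ^ (s + r)) (ψ ℓ))) ≤
      r * (β * (Real.sinh ε * √(L.card : ℝ) + 2 * δ * L.card)) := by
  induction r generalizing s with
  | zero => simp
  | succ r ih =>
    have hβσ : |β * σ| ≤ 1 := by
      rcases hσ with rfl | rfl <;> simpa [abs_of_nonneg hβ] using hβ1
    have hσ2 : σ * σ = 1 := by rcases hσ with rfl | rfl <;> norm_num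
    have hpow : ∀ ℓ p, ℓ ∈ L → |((Q.biasedUser (β * σ) ℓ ^ r) (ψ ℓ)).1 p| ≤ 1 := fun ℓ p hℓ =>
      Q.abs_mixUser_pow_le (biasedDensity_nonneg hβσ ℓ) (sum_biasedDensity _ (hL ℓ hℓ)) (hψ ℓ) r p
    -- Expanding one biased factor as uniform plus a multiple of the parity part leaves `s + 1`
    -- uniform users and `r` biased ones, plus an error with `s` uniform users and one user under
    -- attack.
    have h1 := ih (s + 1) fun m hm => hQ m (by omega)
    -- The `r` biased users belong to the test. Off `L` the test is set to 0: there ℓ may be empty,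
    -- the weights need not sum to 1, and the bound by 1 could fail.
    have h2 := Q.sum_meanEmpty_parityUser_le hε hδ (hQ s le_rfl) L hL
      (fun ℓ => if ℓ ∈ L then (Q.biasedUser (β * σ) ℓ ^ r) (ψ ℓ) else 0) (by
        intro ℓ p
        split_ifs with hℓ
        · exact hpow ℓ p hℓ
        · simp)
    have h3 : ∀ ℓ ∈ L, σ * (Q.meanEmpty ((Q.uniformUser ^ s)
          ((Q.biasedUser (β * σ) ℓ ^ (r + 1)) (ψ ℓ))) -
          Q.meanEmpty ((Q.uniformUser ^ (s + (r + 1))) (ψ ℓ))) =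
        σ * (Q.meanEmpty ((Q.uniformUser ^ (s + 1)) ((Q.biasedUser (β * σ) ℓ ^ r) (ψ ℓ))) -
          Q.meanEmpty ((Q.uniformUser ^ (s + 1 + r)) (ψ ℓ))) +
        β * Q.meanEmpty ((Q.uniformUser ^ s) (Q.parityUser ℓ
          (if ℓ ∈ L then (Q.biasedUser (β * σ) ℓ ^ r) (ψ ℓ) else 0))) := by
      intro ℓ hℓ
      rw [if_pos hℓ, pow_succ' (Q.biasedUser (β * σ) ℓ), Module.End.mul_apply]
      nth_rw 1 [biasedUser_eq]
      rw [LinearMap.add_apply, LinearMap.smul_apply, map_add, map_add, map_smul, map_smul,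
        ← Module.End.mul_apply (Q.uniformUser ^ s) Q.uniformUser, ← pow_succ,
        show s + (r + 1) = s + 1 + r by ring, smul_eq_mul]
      linear_combination (β * Q.meanEmpty ((Q.uniformUser ^ s) (Q.parityUser ℓ
          ((Q.biasedUser (β * σ) ℓ ^ r) (ψ ℓ))))) * hσ2
    rw [Finset.sum_congr rfl h3, Finset.sum_add_distrib]
    have h4 := mul_le_mul_of_nonneg_left h2 hβ
    rw [Finset.mul_sum] at h4
    push_cast
    linarith

/-- The binomial theorem for commuting operators: `r` is the number of users whose coin selects bias
β. -/
theorem meanEmpty_biasedUser_half_pow (β : ℝ) (ℓ : Finset (Fin d)) (ψ : invariantTests W Y)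
    (N : ℕ) :
    Q.meanEmpty ((Q.biasedUser (β / 2) ℓ ^ N) ψ) = (1 / 2) ^ N * ∑ r ∈ Finset.range (N + 1),
      (N.choose r : ℝ) * Q.meanEmpty ((Q.uniformUser ^ (N - r)) ((Q.biasedUser β ℓ ^ r) ψ)) := by
  have hc : Commute (Q.biasedUser β ℓ) Q.uniformUser := Q.mixUser_commute _ _
  rw [biasedUser_half, smul_pow, hc.add_pow, LinearMap.smul_apply, map_smul, smul_eq_mul,
    LinearMap.sum_apply, map_sum]
  congr 1
  refine Finset.sum_congr rfl fun r _ => ?_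
  rw [(hc.pow_pow r (N - r)).eq, ← nsmul_eq_mul', LinearMap.smul_apply, map_nsmul, nsmul_eq_mul,
    Module.End.mul_apply]

theorem sum_choose_mul_cast (N : ℕ) :
    ∑ r ∈ Finset.range (N + 1), (N.choose r : ℝ) * r = N * 2 ^ N / 2 := by
  have h : ∑ r ∈ Finset.range (N + 1), (N.choose r : ℝ) * r =
      ((∑ r ∈ Finset.range (N + 1), r * N.choose r : ℕ) : ℝ) := by
    push_cast
    exact Finset.sum_congr rfl fun r _ => mul_comm _ _
  rw [h, Nat.sum_range_mul_choose]
  rcases N with _ | N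
  · simp
  · push_cast
    rw [pow_succ]
    ring

/-- Robust privacy limits the total advantage in distinguishing the two signs of the bias. -/
theorem sum_meanEmpty_sub_le {ε δ β : ℝ} (hε : 0 ≤ ε) (hδ : 0 ≤ δ) (hβ : 0 ≤ β) (hβ1 : β ≤ 1)
    (hQ : Q.IsRobustlyShufflePrivate ε δ (1 / 3))
    (L : Finset (Finset (Fin d))) (hL : ∀ ℓ ∈ L, ℓ.Nonempty)
    (ψ : Finset (Fin d) → invariantTests W Y) (hψ : ∀ ℓ p, |(ψ ℓ).1 p| ≤ 1)
    (hψ0 : ∀ ℓ p, 0 ≤ (ψ ℓ).1 p) :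
    ∑ ℓ ∈ L, (Q.meanEmpty ((Q.biasedUser (β / 2) ℓ ^ n) (ψ ℓ)) -
      Q.meanEmpty ((Q.biasedUser (-β / 2) ℓ ^ n) (ψ ℓ))) ≤
      2 * n * (β * (Real.sinh ε * √(L.card : ℝ) + 2 * δ * L.card)) + 3 / 4 * L.card := by
  set κ : ℝ := β * (Real.sinh ε * √(L.card : ℝ) + 2 * δ * L.card) with hκ
  have hκ0 : 0 ≤ κ := by
    have := Real.sinh_nonneg_iff.2 hε
    positivity
  set H : ℝ → ℕ → Finset (Fin d) → ℝ := fun b r ℓ =>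
    Q.meanEmpty ((Q.uniformUser ^ (n - r)) ((Q.biasedUser b ℓ ^ r) (ψ ℓ))) with hH
  have hb1 : |β| ≤ 1 := by rwa [abs_of_nonneg hβ]
  have hb2 : |-β| ≤ 1 := by rwa [abs_neg]
  have hu : ∀ x : Cube d, (0 : ℝ) ≤ (fun _ => (2 ^ d)⁻¹) x := fun x => by positivity
  have hu1 : ∑ x : Cube d, (fun _ => ((2 : ℝ) ^ d)⁻¹) x = 1 := by
    rw [Finset.sum_const, Finset.card_univ, nsmul_eq_mul, card_cube]
    exact mul_inv_cancel₀ (by positivity)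
  have htriv : ∀ r, ∑ ℓ ∈ L, (H β r ℓ - H (-β) r ℓ) ≤ L.card := by
    intro r
    refine (Finset.sum_le_sum (g := fun _ => (1 : ℝ)) fun ℓ hℓ => ?_).trans (by simp)
    have h1 : H β r ℓ ≤ 1 := (le_abs_self _).trans (Q.abs_meanEmpty_le
      (Q.abs_mixUser_pow_le hu hu1 (Q.abs_mixUser_pow_le (biasedDensity_nonneg hb1 ℓ)
        (sum_biasedDensity _ (hL ℓ hℓ)) (hψ ℓ) r) _))
    have h2 : 0 ≤ H (-β) r ℓ := Q.meanEmpty_nonneg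
      (Q.mixUser_pow_nonneg hu (Q.mixUser_pow_nonneg (biasedDensity_nonneg hb2 ℓ) (hψ0 ℓ) r) _)
    linarith
  -- One bound, affine in `r`, covers both regimes, so that only the binomial mean is needed: the
  -- linear term is the Markov majorant of the event r ≥ 2n/3.
  have hstep : ∀ r ∈ Finset.range (n + 1), ∑ ℓ ∈ L, (H β r ℓ - H (-β) r ℓ) ≤
      2 * n * κ + 3 / (2 * n) * L.card * r := by
    intro r hr
    have hrn : r ≤ n := Nat.lt_succ_iff.1 (Finset.mem_range.1 hr)
    have hrn' : (r : ℝ) ≤ n := by exact_mod_cast hrn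
    -- The extra 1 counts the user being replaced, who takes part along with the `n - r` uniform
    -- ones.
    by_cases hs : (1 / 3 : ℝ) * n ≤ (n - r : ℕ) + 1
    · have hpriv : ∀ m, n - r ≤ m → IsDifferentiallyPrivate ε δ (Q.view (m + 1)) := by
        intro m hm
        refine hQ (m + 1) (hs.trans ?_)
        push_cast
        have : ((n - r : ℕ) : ℝ) ≤ m := by exact_mod_cast hm
        linarith
      have h1 := Q.sum_meanEmpty_biasedUser_pow_le hε hδ hβ hβ1 (Or.inl rfl) L hL ψ hψ r (n - r)
        hpriv
      have h2 := Q.sum_meanEmpty_biasedUser_pow_le hε hδ hβ hβ1 (Or.inr rfl) L hL ψ hψ r (n - r)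
        hpriv
      have h3 : ∑ ℓ ∈ L, (H β r ℓ - H (-β) r ℓ) ≤ r * κ + r * κ := by
        refine le_trans (le_of_eq ?_) (add_le_add h1 h2)
        rw [← Finset.sum_add_distrib]
        refine Finset.sum_congr rfl fun ℓ _ => ?_
        simp only [hH, mul_one, mul_neg]
        ring
      have h4 : (r : ℝ) * κ ≤ n * κ := mul_le_mul_of_nonneg_right hrn' hκ0
      have h5 : (0 : ℝ) ≤ 3 / (2 * n) * L.card * r := by positivity
      linarith
    · rw [Nat.cast_sub hrn] at hs
      have hn : (0 : ℝ) < n := by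
        rcases Nat.eq_zero_or_pos n with h | h
        · exfalso
          have : (n : ℝ) = 0 := by exact_mod_cast h
          linarith
        · exact_mod_cast h
      have h1 : (1 : ℝ) ≤ 3 / (2 * n) * r := by
        rw [div_mul_eq_mul_div, le_div_iff₀ (by positivity)]
        linarith
      have h2 := htriv r
      have h3 : (L.card : ℝ) ≤ 3 / (2 * n) * L.card * r := by
        calc (L.card : ℝ) = L.card * 1 := (mul_one _).symm
          _ ≤ L.card * (3 / (2 * n) * r) := mul_le_mul_of_nonneg_left h1 (Nat.cast_nonneg _)
          _ = _ := by ring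
      have h4 : 0 ≤ 2 * n * κ := by positivity
      linarith
  have hsum : ∑ ℓ ∈ L, (Q.meanEmpty ((Q.biasedUser (β / 2) ℓ ^ n) (ψ ℓ)) -
      Q.meanEmpty ((Q.biasedUser (-β / 2) ℓ ^ n) (ψ ℓ))) =
      (1 / 2) ^ n * ∑ r ∈ Finset.range (n + 1),
        (n.choose r : ℝ) * ∑ ℓ ∈ L, (H β r ℓ - H (-β) r ℓ) := by
    simp_rw [meanEmpty_biasedUser_half_pow, ← mul_sub, ← Finset.sum_sub_distrib, ← mul_sub]
    rw [← Finset.mul_sum, Finset.sum_comm]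
    simp_rw [Finset.mul_sum]
    rfl
  rw [hsum]
  have hchoose : ∑ r ∈ Finset.range (n + 1), (n.choose r : ℝ) = 2 ^ n := by
    exact_mod_cast Nat.sum_range_choose n
  calc _ ≤ (1 / 2 : ℝ) ^ n * ∑ r ∈ Finset.range (n + 1),
        (n.choose r : ℝ) * (2 * n * κ + 3 / (2 * n) * L.card * r) := by
        gcongr with r hr
        exact hstep r hr
    _ = (1 / 2 : ℝ) ^ n * (2 ^ n * (2 * n * κ) + 3 / (2 * n) * L.card * (n * 2 ^ n / 2)) := by
        congr 1
        rw [← sum_choose_mul_cast, ← hchoose, Finset.sum_mul, Finset.mul_sum,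
          ← Finset.sum_add_distrib]
        exact Finset.sum_congr rfl fun r _ => by ring
    -- The binomial mean n/2 turns 3/(2n) into 3/4. The factor `n / n` is kept because it is 0 when
    -- `n = 0`.
    _ = 2 * n * κ + 3 / 4 * L.card * (n / n) := by
        have : (1 / 2 : ℝ) ^ n * 2 ^ n = 1 := by rw [← mul_pow]; norm_num
        rw [show (3 : ℝ) / (2 * n) = 3 / 2 / n by rw [div_div]]
        linear_combination (2 * n * κ + 3 / 4 * L.card * (n / n)) * this
    _ ≤ _ := by
        have := mul_le_mul_of_nonneg_left (div_self_le_one (n : ℝ))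
          (show (0 : ℝ) ≤ 3 / 4 * L.card by positivity)
        linarith

end Parities

/-- A robustly private protocol that releases parities has many users. -/
theorem card_le_of_releasesParities {n d k : ℕ} {α ε δ : ℝ} (hα0 : 0 < α) (hα : α < 1 / 2)
    (hε : 0 ≤ ε) (hδ : 0 ≤ δ) {Y W : Type*} [MeasurableSpace Y] [MeasurableSpace W]
    (Q : ShuffleProtocol n (Cube d) Y W (Finset (Fin d) → ℝ))
    (hQ : Q.IsRobustlyShufflePrivate ε δ (1 / 3)) (hrel : ReleasesParities k α Q.output) :
    (chooseLE d k : ℝ) ≤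
      40 * n * (α * (Real.sinh ε * √(chooseLE d k : ℝ) + 2 * δ * chooseLE d k)) := by
  obtain ⟨β, hβ0, hβ1, hβα, hβ4⟩ : ∃ β : ℝ, 0 ≤ β ∧ β ≤ 1 ∧ α < β / 2 ∧ β ≤ 4 * α := by
    refine ⟨min (4 * α) 1, le_min (by linarith) zero_le_one, min_le_right _ _, ?_, min_le_left _ _⟩
    rw [lt_div_iff₀ two_pos]
    exact lt_min (by linarith) (by linarith)
  have hL : ∀ ℓ ∈ widthLE d k, ℓ.Nonempty ∧ ℓ.card ≤ k := fun ℓ hℓ => by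
    simpa [widthLE] using hℓ
  have hT : ∀ ℓ : Finset (Fin d), MeasurableSet {F : Finset (Fin d) → ℝ | 0 < F ℓ} := fun ℓ =>
    measurableSet_lt measurable_const (measurable_pi_apply ℓ)
  have h1 := Q.sum_meanEmpty_sub_le hε hδ hβ0 hβ1 hQ (widthLE d k) (fun ℓ hℓ => (hL ℓ hℓ).1)
    (fun ℓ => Q.outputTest (hT ℓ)) (fun ℓ => Q.outputTest_le_one (hT ℓ))
    (fun ℓ => Q.outputTest_nonneg (hT ℓ))
  have h2 : ((widthLE d k).card : ℝ) * (98 / 100) ≤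
      ∑ ℓ ∈ widthLE d k, (Q.meanEmpty ((Q.biasedUser (β / 2) ℓ ^ n) (Q.outputTest (hT ℓ))) -
        Q.meanEmpty ((Q.biasedUser (-β / 2) ℓ ^ n) (Q.outputTest (hT ℓ)))) := by
    rw [← nsmul_eq_mul, ← Finset.sum_const]
    refine Finset.sum_le_sum fun ℓ hℓ => ?_
    have h := hrel.le_sum_sub_sum (β := β / 2) (by linarith) hα0.le hβα (hL ℓ hℓ).1 (hL ℓ hℓ).2
    simp_rw [Q.output_real (hT ℓ), sum_prod_mul_integral_view] at h
    rw [neg_div]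
    exact h
  rw [card_widthLE] at h1 h2
  have h3 : β * (Real.sinh ε * √(chooseLE d k : ℝ) + 2 * δ * chooseLE d k) ≤
      4 * (α * (Real.sinh ε * √(chooseLE d k : ℝ) + 2 * δ * chooseLE d k)) := by
    rw [← mul_assoc]
    refine mul_le_mul_of_nonneg_right hβ4 ?_
    have := Real.sinh_nonneg_iff.2 hε
    positivity
  have h4 := mul_le_mul_of_nonneg_left h3 (show (0 : ℝ) ≤ 2 * n by positivity)
  -- The margin is 98/100 - 3/4 = 23/100, and 8 / (23/100) < 40.
  nlinarith

end ShuffleProtocol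

/-! ### Constants and the condition on δ -/

theorem sinh_le_mul_exp {ε ε₀ : ℝ} (hε : 0 ≤ ε) (h : ε ≤ ε₀) :
    Real.sinh ε ≤ ε * Real.exp ε₀ := by
  have h1 : Real.exp ε ≤ Real.exp ε₀ := Real.exp_le_exp.2 h
  have h2 : 1 ≤ Real.exp ε := Real.one_le_exp hε
  have h3 := Real.add_one_le_exp (-ε)
  have h4 : Real.exp ε * Real.exp (-ε) = 1 := by rw [← Real.exp_add]; simp
  have h5 := mul_le_mul_of_nonneg_left h3 (Real.exp_pos ε).le
  have h6 := mul_le_mul_of_nonneg_left h1 hε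
  have h7 := mul_le_mul_of_nonneg_left h2 hε
  rw [Real.sinh_eq]
  linarith

/-- The condition on `δ` makes its contribution to the advantage negligible. -/
theorem two_mul_delta_mul_le {ε₀ α ε δ N : ℝ} (hε₀ : 0 < ε₀) (hα0 : 0 < α) (hα : α < 1 / 2)
    (hε : 0 < ε) (hεε₀ : ε ≤ ε₀) (hδ : 0 ≤ δ) (hδ1 : δ ≤ 1) (hN : 2 ≤ N)
    (h : δ * Real.log (N / δ) ≤ 1 / ε₀ * (α ^ 2 * ε ^ 2 / N)) :
    2 * δ * N ≤ ε * √N := by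
  have hsq : 1 ≤ √N := Real.one_le_sqrt.2 (by linarith)
  suffices 2 * δ * N ≤ ε by
    exact this.trans (le_mul_of_one_le_right hε.le hsq)
  rcases hδ.eq_or_lt with rfl | hδ0
  · simpa using hε.le
  -- As N / δ ≥ 2, the logarithm is bounded below by a constant; nothing more about it is needed.
  have hlog : 1 / 2 ≤ Real.log (N / δ) := by
    have h1 : Real.log 2 ≤ Real.log (N / δ) := by
      refine Real.log_le_log two_pos ?_
      rw [le_div_iff₀ hδ0]
      nlinarith
    have := Real.log_two_gt_d9
    linarith
  have h1 : δ * (1 / 2) ≤ 1 / ε₀ * (α ^ 2 * ε ^ 2 / N) :=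
    (mul_le_mul_of_nonneg_left hlog hδ).trans h
  -- The choice c = 1/ε₀ trades one factor ε for ε₀, and α² ≤ 1/4 gives the rest.
  have h2 : 1 / ε₀ * (α ^ 2 * ε ^ 2 / N) ≤ ε / 4 / N := by
    rw [← mul_div_assoc]
    refine div_le_div_of_nonneg_right ?_ (by linarith)
    rw [one_div, inv_mul_le_iff₀ hε₀]
    have h3 : α ^ 2 ≤ 1 / 4 := by nlinarith
    have h4 : ε ^ 2 ≤ ε₀ * ε := by nlinarith
    calc α ^ 2 * ε ^ 2 ≤ 1 / 4 * (ε₀ * ε) := by gcongr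
      _ = ε₀ * (ε / 4) := by ring
  have h5 : δ * (1 / 2) * N ≤ ε / 4 := by
    rw [← le_div_iff₀ (by linarith)]
    exact h1.trans h2
  linarith

end ShufflePrivacy

theorem mainTheorem8 (ε₀ : ℝ) (hε₀ : 0 < ε₀) :
    ∃ c : ℝ, 0 < c ∧ ∃ C : ℝ, 0 < C ∧
      ∀ (n d k : ℕ) (α ε δ : ℝ), 2 ≤ d → 1 ≤ k → k ≤ d → 0 < α → α < 1 / 2 →
        0 < ε → ε ≤ ε₀ → 0 ≤ δ → δ ≤ 1 →
        δ * Real.log (ShufflePrivacy.chooseLE d k / δ) ≤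
          c * (α ^ 2 * ε ^ 2 / ShufflePrivacy.chooseLE d k) →
        ∀ (Y : Type*) (W : Type*) [MeasurableSpace Y] [MeasurableSpace W]
          (Q : ShufflePrivacy.ShuffleProtocol n (ShufflePrivacy.Cube d) Y W
            (Finset (Fin d) → ℝ)),
          Q.IsRobustlyShufflePrivate ε δ (1 / 3) →
          ShufflePrivacy.ReleasesParities k α Q.output →
          C * (√(ShufflePrivacy.chooseLE d k : ℝ) / (α * ε)) ≤ n := by
  have hE : 0 < Real.exp ε₀ + 1 := by positivity
  -- In C, the term exp ε₀ comes from sinh ε ≤ ε exp ε₀ and the added 1 from the contribution of δ,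
  -- which is at most ε√N.
  refine ⟨1 / ε₀, by positivity, (40 * (Real.exp ε₀ + 1))⁻¹, by positivity, ?_⟩
  intro n d k α ε δ hd hk _ hα0 hα hε hεε₀ hδ hδ1 hcond Y W _ _ Q hQ hrel
  have hN : (2 : ℝ) ≤ ShufflePrivacy.chooseLE d k := by
    exact_mod_cast hd.trans (ShufflePrivacy.le_chooseLE hk)
  have h1 := ShufflePrivacy.two_mul_delta_mul_le hε₀ hα0 hα hε hεε₀ hδ hδ1 hN hcond
  have h2 := ShufflePrivacy.sinh_le_mul_exp hε.le hεε₀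
  have h3 := Q.card_le_of_releasesParities hα0 hα hε.le hδ hQ hrel
  set N : ℝ := (ShufflePrivacy.chooseLE d k : ℝ)
  have hs : 0 < √N := Real.sqrt_pos.2 (by linarith)
  have h4 : N ≤ 40 * n * (α * ((Real.exp ε₀ + 1) * ε * √N)) := by
    refine h3.trans ?_
    gcongr
    calc Real.sinh ε * √N + 2 * δ * N ≤ ε * Real.exp ε₀ * √N + ε * √N := by gcongr
      _ = _ := by ring
  have h5 : √N ≤ 40 * n * (α * ((Real.exp ε₀ + 1) * ε)) := by
    refine le_of_mul_le_mul_right ?_ hs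
    rw [Real.mul_self_sqrt (by linarith)]
    exact h4.trans_eq (by ring)
  rw [inv_mul_le_iff₀ (by positivity), div_le_iff₀ (by positivity)]
  exact h5.trans_eq (by ring)
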